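/- Let $d\ge 2$ and $0<\sigma<\tfrac12$, and let $R\ge\sqrt d$. Let $\mathrm d\omega$ be the hypersurface measure on the truncated paraboloid $P^{d-1}=\{\xi=(\xi',\xi_d)\in\mathbb R^d:\ \xi_d=|\xi'|^2,\ |\xi_j|\le 1 \text{ for } 1\le j\le d-1\}$, let $$h(\xi)=\sum_{\substack{l\in\mathbb Z^{d-1}\\ 1\le l_1,\dots,l_{d-1}<R^\sigma}}\ \prod_{j=1}^{d-1} 1_{(l_jR^{-\sigma}-R^{-1},\,l_jR^{-\sigma}+R^{-1})}(\xi_j),\qquad g(x)=\int h(\xi)\,e^{2\pi i x\cdot\xi}\,\mathrm d\omega(\xi),$$ so that $\hat g=h\,\mathrm d\omega$. Let $B_R$ be the ball of radius $R$ centred at the origin, let $X$ be the $1$-neighbourhood of $\{(n_1R^\sigma,\dots,n_{d-1}R^\sigma,n_dR^{2\sigma}):n_j\in\mathbb Z\}\cap B_R$, and let $Y$ be the union of the unit cubes $k+[0,1)^d$, $k\in\mathbb Z^d$, that are contained in $B_R$ and meet $X$. Put $\alpha=d-(d+1)\sigma$. Then $\alpha>0$, and the following hold with implied constants that depend only on $d$.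 (i) $Y\subset B_R$ is a finite union of lattice unit cubes, and $|B_r\cap Y|\lesssim r^\alpha$ for all $1\le r\le R$ and all balls $B_r\subset B_R$ of radius $r$. Moreover, for every $K\ge1$, every $\xi'\in[-1,1]^{d-1}$ and every $a\in\mathbb R^d$, the tube of all $x$ for which the components of $x-a$ parallel and orthogonal to the normal $(-2\xi',1)$ of the paraboloid at $(\xi',|\xi'|^2)$ have length at most $KR$ and $KR^{1/2}$ respectively meets at most a fraction $\lesssim K^{d-1}R^{-\frac{d-1}2}$ of the unit cubes that make up $Y$. (So $Y$ and $v=g$, $\varphi=h$ satisfy the hypotheses of the fractal $L^2$ estimate $\|v\|_{L^2(Y)}\lesssim_\varepsilon R^{\frac1{d+1}(\alpha-\frac{d-1}2)+\varepsilon}\|\varphi\|_{L^2(\mathrm d\omega)}$, $\hat v=\varphi\,\mathrm d\omega$.) (ii) $\|g\|_{L^2(Y)}\sim R^{\frac{d-3}2\sigma-\frac{d-2}2}$, and for every $\varepsilon\ge0$ $$R^{\frac1{d+1}\left(\alpha-\frac{d-1}2\right)+\varepsilon}\,\|h\|_{L^2(\mathrm d\omega)}\sim R^{\frac{d-3}2\sigma-\frac{d-2}2+\varepsilon}.$$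 (iii) Consequently the estimate is almost sharp: for every $\beta<\frac1{d+1}\left(\alpha-\frac{d-1}2\right)$ and every $A$ one has $\|g\|_{L^2(Y)}>A\,R^\beta\,\|h\|_{L^2(\mathrm d\omega)}$ for all sufficiently large $R$ (with $\sigma$ fixed). -/

import Mathlib

/-!
Throughout, the ambient space is `ℝ^d` with `d = n + 1`; a point is `ξ = (ξ', ξ_d)` with
`ξ' ∈ ℝ^n` the first `d - 1` coordinates.
-/

noncomputable section

namespace BBCRV

open MeasureTheory

/-- The point `(ξ', |ξ'|²)` of the paraboloid above `ξ' ∈ ℝ^(d-1)`. -/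
def graphPt {n : ℕ} (ξ : EuclideanSpace ℝ (Fin n)) : EuclideanSpace ℝ (Fin (n + 1)) :=
  WithLp.toLp 2 (Fin.snoc (α := fun _ => ℝ) (fun j => ξ j) (‖ξ‖ ^ 2))

/-- The parameter domain `{|ξ_j| ≤ 1}` of the truncated paraboloid. -/
def paramCube (n : ℕ) : Set (EuclideanSpace ℝ (Fin n)) := {ξ | ∀ j, |ξ j| ≤ 1}

/-- The hypersurface measure `dω` on the truncated paraboloid
`{ξ_d = |ξ'|², |ξ_j| ≤ 1 for j ≤ d - 1}`, a measure on `ℝ^d`: the area element of the graph of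
`ξ' ↦ |ξ'|²` is `√(1 + |2 ξ'|²) dξ'`. -/
def surfaceMeasure (n : ℕ) : Measure (EuclideanSpace ℝ (Fin (n + 1))) :=
  ((volume.restrict (paramCube n)).withDensity
    (fun ξ => ENNReal.ofReal (Real.sqrt (1 + 4 * ‖ξ‖ ^ 2)))).map graphPt

/-- The box `∏_j (l_j R^{-σ} - R^{-1}, l_j R^{-σ} + R^{-1})` in the first `d - 1` coordinates. -/
def freqBox {n : ℕ} (σ R : ℝ) (l : Fin n → ℤ) : Set (EuclideanSpace ℝ (Fin (n + 1))) :=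
  {ξ | ∀ j : Fin n, ξ j.castSucc ∈
    Set.Ioo ((l j : ℝ) * R ^ (-σ) - R⁻¹) ((l j : ℝ) * R ^ (-σ) + R⁻¹)}

/-- The density `h`: the sum of the indicators of the boxes over the integer vectors `l` with
`1 ≤ l_j < R^σ` (for an integer, `l_j < R^σ` is the same as `l_j < ⌈R^σ⌉`). -/
def h (n : ℕ) (σ R : ℝ) (ξ : EuclideanSpace ℝ (Fin (n + 1))) : ℂ :=
  ∑ l ∈ Fintype.piFinset (fun _ : Fin n => Finset.Ico (1 : ℤ) ⌈R ^ σ⌉),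
    (freqBox σ R l).indicator (fun _ => (1 : ℂ)) ξ

/-- The Barceló–Bennett–Carbery–Ruiz–Vilela function `g`, the inverse Fourier transform of the
measure `h dω`: `g(x) = ∫ h(ξ) e^{2πi x·ξ} dω(ξ)`. -/
def g (n : ℕ) (σ R : ℝ) (x : EuclideanSpace ℝ (Fin (n + 1))) : ℂ :=
  ∫ ξ, h n σ R ξ * Complex.exp (2 * Real.pi * Complex.I * (inner ℝ x ξ : ℝ)) ∂(surfaceMeasure n)

/-- The points `(n_1 R^σ, …, n_{d-1} R^σ, n_d R^{2σ})` with integers `n_j`. -/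
def peakLattice (n : ℕ) (σ R : ℝ) : Set (EuclideanSpace ℝ (Fin (n + 1))) :=
  {x | ∃ m : Fin (n + 1) → ℤ, (∀ j : Fin n, x j.castSucc = (m j.castSucc : ℝ) * R ^ σ) ∧
    x (Fin.last n) = (m (Fin.last n) : ℝ) * R ^ (2 * σ)}

/-- The set `X`: the `1`-neighbourhood of the points of the peak lattice in `B_R`. -/
def peakNbhd (n : ℕ) (σ R : ℝ) : Set (EuclideanSpace ℝ (Fin (n + 1))) :=
  Metric.thickening 1 (peakLattice n σ R ∩ Metric.ball 0 R)

/-- The lattice unit cube with lowest corner `k ∈ ℤ^d`. -/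
def unitCube {m : ℕ} (k : Fin m → ℤ) : Set (EuclideanSpace ℝ (Fin m)) :=
  {x | ∀ i, (k i : ℝ) ≤ x i ∧ x i < (k i : ℝ) + 1}

/-- The union of a collection of lattice unit cubes. -/
def cubeUnion {m : ℕ} (Q : Set (Fin m → ℤ)) : Set (EuclideanSpace ℝ (Fin m)) :=
  ⋃ k ∈ Q, unitCube k

/-- The lattice unit cubes that lie in `B_R` and meet `X`; their union is `Y`. -/
def peakCubes (n : ℕ) (σ R : ℝ) : Set (Fin (n + 1) → ℤ) :=
  {k | unitCube k ⊆ Metric.ball 0 R ∧ (unitCube k ∩ peakNbhd n σ R).Nonempty}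

/-- Fractal structure of dimension `α` between the scales `1` and `R`, with implied constant `A`:
`|B_r ∩ Y| ≤ A r^α` for all `1 ≤ r ≤ R` and all balls `B_r ⊆ B_R`. -/
def HasFractalStructure {m : ℕ} (A α R : ℝ) (Y : Set (EuclideanSpace ℝ (Fin m))) : Prop :=
  ∀ (x : EuclideanSpace ℝ (Fin m)) (r : ℝ), 1 ≤ r → r ≤ R →
    Metric.ball x r ⊆ Metric.ball 0 R →
      volume (Metric.ball x r ∩ Y) ≤ ENNReal.ofReal (A * r ^ α)

/-- The upward normal vector `(-2 ξ', 1)` of the paraboloid at `(ξ', |ξ'|²)`. -/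
def normalVec {n : ℕ} (ξ : EuclideanSpace ℝ (Fin n)) : EuclideanSpace ℝ (Fin (n + 1)) :=
  WithLp.toLp 2 (Fin.snoc (α := fun _ => ℝ) (fun j => -2 * ξ j) 1)

/-- The tube with centre `a`, thickness `K R^{1/2}` and length `K R` (up to factors `2`) in the
direction normal to the paraboloid at `(ξ', |ξ'|²)`: the points whose difference with `a` has
component of length at most `K R` along the normal line and at most `K R^{1/2}` orthogonally
to it. -/
def tube {n : ℕ} (K R : ℝ) (ξ : EuclideanSpace ℝ (Fin n))
    (a : EuclideanSpace ℝ (Fin (n + 1))) : Set (EuclideanSpace ℝ (Fin (n + 1))) :=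
  {x | ‖(Submodule.span ℝ {normalVec ξ}).starProjection (x - a)‖ ≤ K * R ∧
    ‖(x - a) - (Submodule.span ℝ {normalVec ξ}).starProjection (x - a)‖ ≤ K * R ^ (1 / 2 : ℝ)}

/-- Each wave packet tube at scale `R` (any position, direction normal to the truncated
paraboloid, essential support enlarged by any factor `K ≥ 1`) hits at most the fraction
`A K^(d-1) R^{-(d-1)/2}` of the unit cubes of the collection `Q`. -/
def TubesHitSmallFraction {n : ℕ} (A R : ℝ) (Q : Set (Fin (n + 1) → ℤ)) : Prop :=
  ∀ K : ℝ, 1 ≤ K → ∀ ξ ∈ paramCube n, ∀ a : EuclideanSpace ℝ (Fin (n + 1)),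
    ({k ∈ Q | (unitCube k ∩ tube K R ξ a).Nonempty}.ncard : ℝ) ≤
      A * K ^ n * R ^ (-(n : ℝ) / 2) * (Q.ncard : ℝ)

end BBCRV

end

/-!
The density `h` is nonnegative, so `|g| ≤ ∫ h dω` everywhere. Conversely, if `p` is in the peak
lattice and `η = R^(-σ) l` is the centre of a frequency box, then `p · (η, |η|²)` is an integer. For
`|p| ≤ δR` with a small `δ = δ(d)`, the phase `x · ξ` therefore stays within `1/6` of an integer for
all `x` within `δ` of `p` and all `ξ` in the support of `h`; there is no cancellation, and
`|g(x)| ≥ ½ ∫ h dω`. About `R^α` unit cubes make up `Y`, and such `x` fill a fixed fraction of it,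
hence `‖g‖_{L²(Y)} ∼ R^(α/2) ∫ h dω`. The frequency boxes overlap at most `3^(d-1)` times, so that
`‖h‖₂² ∼ ∫ h dω ∼ R^((d-1)(σ-1))`.

A cube of `Y` is close to a point of the peak lattice, and the cubes in a ball or a tube are
bounded by counting lattice points. In a tube the last coordinate takes at most `∼ R^(1-2σ)` values,
and for each of them the other coordinates are confined to a box of side `∼ K R^(1/2)`: the normal
directions are transverse to the horizontal hyperplane.
-/

noncomputable section

namespace BBCRV

open MeasureTheory Filter
open scoped ENNReal Finset

section Comparable

/-- `x ∼ a` with implied constants `c` and `C`. The quantity `x` is extended real because it stands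
for a measure or an `L^p` norm, while its size `a` is an explicit real number. -/
def Comparable (c C a : ℝ) (x : ℝ≥0∞) : Prop :=
  ENNReal.ofReal (c * a) ≤ x ∧ x ≤ ENNReal.ofReal (C * a)

variable {c C a : ℝ} {x : ℝ≥0∞}

theorem Comparable.mono {c' C' : ℝ} (hx : Comparable c C a x) (hc : c' ≤ c) (hC : C ≤ C')
    (ha : 0 ≤ a) : Comparable c' C' a x :=
  ⟨(ENNReal.ofReal_le_ofReal (by gcongr)).trans hx.1,
    hx.2.trans (ENNReal.ofReal_le_ofReal (by gcongr))⟩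

theorem Comparable.trans {c' C' b : ℝ} (hx : Comparable c C a x) (hc : 0 ≤ c) (hC : 0 ≤ C)
    (hba : c' * b ≤ a) (hab : a ≤ C' * b) : Comparable (c * c') (C * C') b x := by
  refine ⟨le_trans (ENNReal.ofReal_le_ofReal ?_) hx.1,
    hx.2.trans (ENNReal.ofReal_le_ofReal ?_)⟩ <;> rw [mul_assoc] <;> gcongr

theorem Comparable.ofReal_mul {b : ℝ} (hx : Comparable c C a x) (hb : 0 ≤ b) :
    Comparable c C (b * a) (ENNReal.ofReal b * x) := by
  rw [Comparable, mul_left_comm, mul_left_comm C, ENNReal.ofReal_mul hb, ENNReal.ofReal_mul hb]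
  exact ⟨mul_le_mul_right hx.1 _, mul_le_mul_right hx.2 _⟩

theorem ofReal_sqrt (t : ℝ) : ENNReal.ofReal √t = ENNReal.ofReal t ^ (1 / 2 : ℝ) := by
  rcases le_total 0 t with ht | ht
  · rw [Real.sqrt_eq_rpow, ENNReal.ofReal_rpow_of_nonneg ht (by norm_num)]
  · simp [Real.sqrt_eq_zero_of_nonpos ht, ENNReal.ofReal_of_nonpos ht]

theorem Comparable.sqrt (hx : Comparable c C a x) (ha : 0 ≤ a) :
    Comparable √c √C √a (x ^ (1 / 2 : ℝ)) := by
  rw [Comparable, ← Real.sqrt_mul' c ha, ← Real.sqrt_mul' C ha, ofReal_sqrt, ofReal_sqrt]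
  exact ⟨ENNReal.rpow_le_rpow hx.1 (by norm_num), ENNReal.rpow_le_rpow hx.2 (by norm_num)⟩

theorem Comparable.sum {ι : Type*} {s : Finset ι} {f : ι → ℝ≥0∞}
    (hf : ∀ i ∈ s, Comparable c C a (f i)) : Comparable c C (#s * a) (∑ i ∈ s, f i) := by
  have hcard : (0 : ℝ) ≤ #s := Nat.cast_nonneg _
  rw [Comparable, mul_left_comm, mul_left_comm C, ENNReal.ofReal_mul hcard,
    ENNReal.ofReal_mul hcard, ENNReal.ofReal_natCast, ← nsmul_eq_mul, ← nsmul_eq_mul]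
  exact ⟨s.card_nsmul_le_sum f _ fun i hi => (hf i hi).1,
    s.sum_le_card_nsmul f _ fun i hi => (hf i hi).2⟩

theorem eventually_ofReal_mul_rpow_mul_lt {u v : ℝ → ℝ≥0∞} {b β : ℝ} (hc : 0 < c) (hC : 0 ≤ C)
    (hu : ∀ᶠ R in atTop, ENNReal.ofReal (c * R ^ a) ≤ u R)
    (hv : ∀ᶠ R in atTop, v R ≤ ENNReal.ofReal (C * R ^ b)) (hβ : β + b < a) (A : ℝ) :
    ∀ᶠ R in atTop, ENNReal.ofReal (A * R ^ β) * v R < u R := by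
  filter_upwards [hu, hv, eventually_gt_atTop 0,
    (tendsto_rpow_atTop (sub_pos.2 hβ)).eventually_gt_atTop (A * C / c)] with R hu hv hR hlarge
  refine ((mul_le_mul_right hv _).trans_lt ?_).trans_le hu
  rw [← ENNReal.ofReal_mul' (by positivity), ENNReal.ofReal_lt_ofReal_iff (by positivity)]
  rw [div_lt_iff₀ hc] at hlarge
  calc A * R ^ β * (C * R ^ b) = A * C * R ^ (β + b) := by rw [Real.rpow_add hR]; ring
    _ < R ^ (a - (β + b)) * c * R ^ (β + b) := by gcongr
    _ = c * R ^ a := by rw [mul_right_comm, ← Real.rpow_add hR]; ring_nf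

end Comparable

section LatticeCounting

theorem cast_toNat_eq_max (k : ℤ) : (k.toNat : ℝ) = max (k : ℝ) 0 := by
  exact_mod_cast congrArg (Int.cast (R := ℝ)) (Int.toNat_eq_max k)

/-- The integers `m` with `|m * s - t| ≤ ρ`, for `0 < s`. -/
def multiplesNear (s t ρ : ℝ) : Finset ℤ := Finset.Icc ⌈(t - ρ) / s⌉ ⌊(t + ρ) / s⌋

theorem mem_multiplesNear {s t ρ : ℝ} (hs : 0 < s) {m : ℤ} :
    m ∈ multiplesNear s t ρ ↔ |m * s - t| ≤ ρ := by
  rw [multiplesNear, Finset.mem_Icc, Int.ceil_le, Int.le_floor, div_le_iff₀ hs, le_div_iff₀ hs,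
    abs_sub_le_iff]
  constructor <;> rintro ⟨_, _⟩ <;> constructor <;> linarith

theorem card_multiplesNear_le {s ρ : ℝ} (hs : 0 < s) (hρ : 0 ≤ ρ) (t : ℝ) :
    (#(multiplesNear s t ρ) : ℝ) ≤ 2 * ρ / s + 1 := by
  have hwidth : (t + ρ) / s - (t - ρ) / s = 2 * ρ / s := by ring
  rw [multiplesNear, Int.card_Icc, cast_toNat_eq_max]
  push_cast
  exact max_le (by linarith [Int.floor_le ((t + ρ) / s), Int.le_ceil ((t - ρ) / s)])
    (by positivity)

theorem div_le_card_multiplesNear_zero {s ρ : ℝ} (hs : 0 < s) (hρ : 0 ≤ ρ) :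
    ρ / s ≤ #(multiplesNear s 0 ρ) := by
  have hsub : Finset.Icc 0 ⌊ρ / s⌋ ⊆ multiplesNear s 0 ρ := by
    rw [multiplesNear, zero_add, zero_sub]
    exact Finset.Icc_subset_Icc_left (Int.ceil_le.2 (by
      rw [Int.cast_zero, neg_div, neg_nonpos]; positivity))
  calc ρ / s ≤ ((⌊ρ / s⌋ + 1 : ℤ) : ℝ) := by
        push_cast; exact (Int.lt_floor_add_one _).le
    _ ≤ (#(Finset.Icc 0 ⌊ρ / s⌋) : ℝ) := by
        rw [Int.card_Icc, sub_zero]; exact_mod_cast Int.self_le_toNat _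
    _ ≤ #(multiplesNear s 0 ρ) := by exact_mod_cast Finset.card_le_card hsub

variable {ι : Type*} [Fintype ι]

/-- The integer vectors `m` for which the point `(m i * s i)_i` of the lattice with spacings `s i`
lies in the box with centre `t` and half-widths `ρ i`. -/
def latticePointsNear [DecidableEq ι] (s t ρ : ι → ℝ) : Finset (ι → ℤ) :=
  Fintype.piFinset fun i => multiplesNear (s i) (t i) (ρ i)

theorem mem_latticePointsNear [DecidableEq ι] {s t ρ : ι → ℝ} (hs : ∀ i, 0 < s i) {m : ι → ℤ} :
    m ∈ latticePointsNear s t ρ ↔ ∀ i, |m i * s i - t i| ≤ ρ i := by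
  simp only [latticePointsNear, Fintype.mem_piFinset, mem_multiplesNear (hs _)]

theorem card_latticePointsNear_le [DecidableEq ι] {s ρ : ι → ℝ} (hs : ∀ i, 0 < s i)
    (hρ : ∀ i, 0 ≤ ρ i) (t : ι → ℝ) :
    (#(latticePointsNear s t ρ) : ℝ) ≤ ∏ i, (2 * ρ i / s i + 1) := by
  rw [latticePointsNear, Fintype.card_piFinset, Nat.cast_prod]
  gcongr with i
  exact card_multiplesNear_le (hs i) (hρ i) (t i)

theorem prod_div_le_card_latticePointsNear_zero [DecidableEq ι] {s ρ : ι → ℝ}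
    (hs : ∀ i, 0 < s i) (hρ : ∀ i, 0 ≤ ρ i) : ∏ i, ρ i / s i ≤ #(latticePointsNear s 0 ρ) := by
  rw [latticePointsNear, Fintype.card_piFinset, Nat.cast_prod]
  exact Finset.prod_le_prod (fun i _ => div_nonneg (hρ i) (hs i).le)
    fun i _ => div_le_card_multiplesNear_zero (hs i) (hρ i)

theorem ncard_le_of_forall_exists_near {Q : Set (ι → ℤ)} {S : Finset (ι → ℤ)}
    {c : (ι → ℤ) → ι → ℝ} (hQ : ∀ k ∈ Q, ∃ m ∈ S, ∀ i, |k i - c m i| ≤ 2) :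
    Q.ncard ≤ 5 ^ Fintype.card ι * #S := by
  classical
  let near (m : ι → ℤ) : Finset (ι → ℤ) := latticePointsNear (fun _ => 1) (c m) fun _ => 2
  have hfibre (m : ι → ℤ) : #(near m) ≤ 5 ^ Fintype.card ι := by
    have hcard := card_latticePointsNear_le (s := fun _ : ι => 1) (ρ := fun _ => 2)
      (fun _ => one_pos) (fun _ => zero_le_two) (c m)
    norm_num at hcard
    exact_mod_cast hcard
  have hsub : Q ⊆ S.biUnion near := fun k hk => by
    obtain ⟨m, hm, hkm⟩ := hQ k hk
    refine Finset.mem_coe.2 (Finset.mem_biUnion.2 ⟨m, hm, ?_⟩)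
    exact (mem_latticePointsNear fun _ => one_pos).2 (by simpa only [mul_one] using hkm)
  calc Q.ncard ≤ (S.biUnion near : Set (ι → ℤ)).ncard :=
        Set.ncard_le_ncard hsub (Finset.finite_toSet _)
    _ = #(S.biUnion near) := Set.ncard_coe_finset _
    _ ≤ #S * 5 ^ Fintype.card ι := Finset.card_biUnion_le_card_mul _ _ _ fun m _ => hfibre m
    _ = 5 ^ Fintype.card ι * #S := mul_comm _ _

/-- The horizontal position `t` of the box may depend on the height `m (Fin.last n)`: for each of
the admissible heights one counts a product of intervals. -/
theorem card_le_prod_of_shear {n : ℕ} {S : Finset (Fin (n + 1) → ℤ)} {s ρ : Fin (n + 1) → ℝ}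
    {t : ℤ → Fin n → ℝ} {t' : ℝ} (hs : ∀ i, 0 < s i) (hρ : ∀ i, 0 ≤ ρ i)
    (hlast : ∀ m ∈ S, |m (Fin.last n) * s (Fin.last n) - t'| ≤ ρ (Fin.last n))
    (hinit : ∀ m ∈ S, ∀ j : Fin n,
      |m j.castSucc * s j.castSucc - t (m (Fin.last n)) j| ≤ ρ j.castSucc) :
    (#S : ℝ) ≤ ∏ i, (2 * ρ i / s i + 1) := by
  have hfibre (z : ℤ) : (#{m ∈ S | m (Fin.last n) = z} : ℝ) ≤
      ∏ j : Fin n, (2 * ρ j.castSucc / s j.castSucc + 1) := by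
    have hs' (j : Fin n) : 0 < s j.castSucc := hs _
    let T : Finset (Fin n → ℤ) :=
      latticePointsNear (fun j => s j.castSucc) (t z) fun j => ρ j.castSucc
    have hmaps : ∀ m ∈ S.filter (· (Fin.last n) = z), (fun j : Fin n => m j.castSucc) ∈ T := by
      intro m hm
      obtain ⟨hmS, rfl⟩ := Finset.mem_filter.1 hm
      exact (mem_latticePointsNear hs').2 (hinit m hmS)
    have hinj : Set.InjOn (fun (m : Fin (n + 1) → ℤ) (j : Fin n) => m j.castSucc)
        {m | m ∈ S.filter (· (Fin.last n) = z)} := by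
      intro m hm m' hm' hmm'
      have hlast' : m (Fin.last n) = m' (Fin.last n) :=
        (Finset.mem_filter.1 hm).2.trans (Finset.mem_filter.1 hm').2.symm
      exact funext (Fin.lastCases hlast' fun j => congrFun hmm' j)
    exact (Nat.cast_le.2 (Finset.card_le_card_of_injOn _ hmaps hinj)).trans
      (card_latticePointsNear_le hs' (fun j => hρ j.castSucc) (t z))
  have hheight : ∀ m ∈ S, m (Fin.last n) ∈ multiplesNear (s (Fin.last n)) t' (ρ (Fin.last n)) :=
    fun m hm => (mem_multiplesNear (hs _)).2 (hlast m hm)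
  have hnonneg (i : Fin (n + 1)) : 0 ≤ 2 * ρ i / s i + 1 := by
    have := hs i; have := hρ i; positivity
  rw [Finset.card_eq_sum_card_fiberwise hheight, Nat.cast_sum, Fin.prod_univ_castSucc, mul_comm]
  refine (Finset.sum_le_card_nsmul _ _ _ fun z _ => hfibre z).trans ?_
  rw [nsmul_eq_mul]
  exact mul_le_mul_of_nonneg_right (card_multiplesNear_le (hs _) (hρ _) t')
    (Finset.prod_nonneg fun j _ => hnonneg j.castSucc)

end LatticeCounting

section Density

variable {n : ℕ} {σ R : ℝ}

theorem measurableSet_setOf_forall_mem {α β ι : Type*} [MeasurableSpace α] [MeasurableSpace β]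
    [Countable ι] {f : ι → α → β} {t : ι → Set β} (hf : ∀ i, Measurable (f i))
    (ht : ∀ i, MeasurableSet (t i)) : MeasurableSet {a | ∀ i, f i a ∈ t i} := by
  rw [Set.ofPred_forall]
  exact .iInter fun i => hf i (ht i)

theorem volume_setOf_forall_coord_mem {ι : Type*} [Fintype ι] (t : ι → Set ℝ) :
    volume {x : EuclideanSpace ℝ ι | ∀ i, x i ∈ t i} = ∏ i, volume (t i) := by
  rw [← volume_pi_pi, ← (EuclideanSpace.volume_preserving_symm_measurableEquiv_toLp
    ι).measure_preimage_equiv]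
  congr 1
  ext x
  simp [Set.mem_pi]

theorem measurableSet_paramCube (n : ℕ) : MeasurableSet (paramCube n) :=
  measurableSet_setOf_forall_mem (f := fun j (ξ : EuclideanSpace ℝ (Fin n)) => |ξ j|)
    (fun _ => by fun_prop) fun _ => measurableSet_Iic

theorem measurableSet_freqBox (σ R : ℝ) (l : Fin n → ℤ) : MeasurableSet (freqBox σ R l) :=
  measurableSet_setOf_forall_mem
    (f := fun (j : Fin n) (ξ : EuclideanSpace ℝ (Fin (n + 1))) => ξ j.castSucc)
    (fun _ => by fun_prop) fun _ => measurableSet_Ioo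

theorem measurable_h (n : ℕ) (σ R : ℝ) : Measurable (h n σ R) :=
  Finset.measurable_fun_sum _ fun l _ => measurable_const.indicator (measurableSet_freqBox σ R l)

@[simp]
theorem graphPt_castSucc (ξ : EuclideanSpace ℝ (Fin n)) (j : Fin n) :
    graphPt ξ j.castSucc = ξ j := by
  simp [graphPt]

@[simp]
theorem graphPt_last (ξ : EuclideanSpace ℝ (Fin n)) : graphPt ξ (Fin.last n) = ‖ξ‖ ^ 2 := by
  simp [graphPt]

theorem measurable_graphPt (n : ℕ) : Measurable (graphPt (n := n)) := by
  refine (WithLp.measurable_toLp 2 _).comp (measurable_pi_lambda _ (Fin.lastCases ?_ fun j => ?_))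
  · simp only [Fin.snoc_last]; fun_prop
  · simp only [Fin.snoc_castSucc]; fun_prop

theorem norm_sq_le_of_mem_paramCube {ξ : EuclideanSpace ℝ (Fin n)} (hξ : ξ ∈ paramCube n) :
    ‖ξ‖ ^ 2 ≤ n := by
  rw [EuclideanSpace.norm_sq_eq]
  calc ∑ j, ‖ξ j‖ ^ 2 ≤ ∑ _j : Fin n, (1 : ℝ) :=
        Finset.sum_le_sum fun j _ => pow_le_one₀ (norm_nonneg _) (hξ j)
    _ = n := by simp

theorem surfaceMeasure_apply {A : Set (EuclideanSpace ℝ (Fin (n + 1)))} (hA : MeasurableSet A) :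
    surfaceMeasure n A =
      ∫⁻ ξ in graphPt ⁻¹' A ∩ paramCube n, ENNReal.ofReal √(1 + 4 * ‖ξ‖ ^ 2) := by
  have hA' := measurable_graphPt n hA
  rw [surfaceMeasure, Measure.map_apply (measurable_graphPt n) hA,
    withDensity_apply _ hA', Measure.restrict_restrict hA']

theorem surfaceMeasure_le {A : Set (EuclideanSpace ℝ (Fin (n + 1)))} (hA : MeasurableSet A) :
    surfaceMeasure n A ≤ ENNReal.ofReal (1 + 4 * n) * volume (graphPt ⁻¹' A) := by
  have hdensity {ξ : EuclideanSpace ℝ (Fin n)} (hξ : ξ ∈ paramCube n) :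
      √(1 + 4 * ‖ξ‖ ^ 2) ≤ 1 + 4 * n := by
    rw [Real.sqrt_le_left (by positivity)]
    nlinarith [norm_sq_le_of_mem_paramCube hξ, sq_nonneg (n : ℝ)]
  calc surfaceMeasure n A ≤ ∫⁻ _ in graphPt ⁻¹' A ∩ paramCube n, ENNReal.ofReal (1 + 4 * n) := by
        rw [surfaceMeasure_apply hA]
        exact setLIntegral_mono' ((measurable_graphPt n hA).inter (measurableSet_paramCube n))
          fun ξ hξ => ENNReal.ofReal_le_ofReal (hdensity hξ.2)
    _ = ENNReal.ofReal (1 + 4 * n) * volume (graphPt ⁻¹' A ∩ paramCube n) := setLIntegral_const _ _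
    _ ≤ ENNReal.ofReal (1 + 4 * n) * volume (graphPt ⁻¹' A) := by
        gcongr; exact Set.inter_subset_left

theorem le_surfaceMeasure {A : Set (EuclideanSpace ℝ (Fin (n + 1)))} (hA : MeasurableSet A) :
    volume (graphPt ⁻¹' A ∩ paramCube n) ≤ surfaceMeasure n A := by
  rw [surfaceMeasure_apply hA, ← setLIntegral_one]
  refine lintegral_mono fun ξ => ?_
  rw [ENNReal.one_le_ofReal, Real.one_le_sqrt]
  nlinarith [sq_nonneg ‖ξ‖]

/-- The integer vectors over which the sum defining `h` runs. -/
def boxIndices (n : ℕ) (σ R : ℝ) : Finset (Fin n → ℤ) :=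
  Fintype.piFinset fun _ => Finset.Ico 1 ⌈R ^ σ⌉

theorem mem_boxIndices {l : Fin n → ℤ} :
    l ∈ boxIndices n σ R ↔ ∀ j, 1 ≤ l j ∧ (l j : ℝ) < R ^ σ := by
  simp [boxIndices, Int.lt_ceil]

theorem half_le_card_Ico_one_ceil {t : ℝ} (ht : 1 < t) : t / 2 ≤ #(Finset.Ico 1 ⌈t⌉) := by
  have hceil : (2 : ℝ) ≤ ⌈t⌉ := by
    have : 1 < ⌈t⌉ := Int.lt_ceil.2 (by rwa [Int.cast_one])
    exact_mod_cast this
  rw [Int.card_Ico, cast_toNat_eq_max]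
  push_cast
  exact le_max_of_le_left (by linarith [Int.le_ceil t])

theorem card_Ico_one_ceil_le {t : ℝ} (ht : 0 ≤ t) : (#(Finset.Ico 1 ⌈t⌉) : ℝ) ≤ t := by
  rw [Int.card_Ico, cast_toNat_eq_max]
  push_cast
  exact max_le (by linarith [Int.ceil_lt_add_one t]) ht

theorem pow_half_le_card_boxIndices (n : ℕ) (hσ : 0 < σ) (hR : 1 < R) :
    (R ^ σ / 2) ^ n ≤ #(boxIndices n σ R) := by
  rw [boxIndices, Fintype.card_piFinset_const, Nat.cast_pow]
  gcongr
  exact half_le_card_Ico_one_ceil (Real.one_lt_rpow hR hσ)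

theorem card_boxIndices_le (n : ℕ) (σ : ℝ) (hR : 0 ≤ R) :
    (#(boxIndices n σ R) : ℝ) ≤ (R ^ σ) ^ n := by
  rw [boxIndices, Fintype.card_piFinset_const, Nat.cast_pow]
  gcongr
  exact card_Ico_one_ceil_le (by positivity)

theorem mul_rpow_neg_lt_one_of_mem_boxIndices (hR : 0 < R) {l : Fin n → ℤ}
    (hl : l ∈ boxIndices n σ R) (j : Fin n) : l j * R ^ (-σ) < 1 := by
  rw [Real.rpow_neg hR.le, ← div_eq_mul_inv, div_lt_one (by positivity)]
  exact (mem_boxIndices.1 hl j).2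

theorem surfaceMeasure_freqBox_le (hR : 0 ≤ R) (σ : ℝ) (l : Fin n → ℤ) :
    surfaceMeasure n (freqBox σ R l) ≤ ENNReal.ofReal ((1 + 4 * n) * 2 ^ n * R⁻¹ ^ n) := by
  have hvol : volume (graphPt ⁻¹' freqBox σ R l) = ENNReal.ofReal ((2 * R⁻¹) ^ n) := by
    have hpre : graphPt ⁻¹' freqBox σ R l = {ξ : EuclideanSpace ℝ (Fin n) | ∀ j, ξ j ∈
        Set.Ioo (l j * R ^ (-σ) - R⁻¹) (l j * R ^ (-σ) + R⁻¹)} := by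
      ext ξ; simp [freqBox]
    rw [hpre, volume_setOf_forall_coord_mem, ENNReal.ofReal_pow (by positivity)]
    simp only [Real.volume_Ioo, add_sub_sub_cancel, ← two_mul, Finset.prod_const,
      Finset.card_univ, Fintype.card_fin]
  rw [mul_assoc, ← mul_pow, ENNReal.ofReal_mul (by positivity), ← hvol]
  exact surfaceMeasure_le (measurableSet_freqBox σ R l)

/-- The half of the box below its centre stays inside the truncated paraboloid. -/
theorem le_surfaceMeasure_freqBox (hR : 1 ≤ R) {l : Fin n → ℤ} (hl : l ∈ boxIndices n σ R) :
    ENNReal.ofReal (R⁻¹ ^ n) ≤ surfaceMeasure n (freqBox σ R l) := by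
  have hR0 : 0 < R := by linarith
  have hsub : {ξ : EuclideanSpace ℝ (Fin n) | ∀ j, ξ j ∈
      Set.Ioo (l j * R ^ (-σ) - R⁻¹) (l j * R ^ (-σ))} ⊆
      graphPt ⁻¹' freqBox σ R l ∩ paramCube n := by
    intro ξ hξ
    refine ⟨fun j => ?_, fun j => ?_⟩
    · rw [graphPt_castSucc]
      exact ⟨(hξ j).1, (hξ j).2.trans (lt_add_of_pos_right _ (by positivity))⟩
    · have hl1 : (1 : ℝ) ≤ l j := by exact_mod_cast (mem_boxIndices.1 hl j).1
      have hcenter : 0 ≤ l j * R ^ (-σ) := by positivity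
      exact abs_le.2 ⟨by linarith [(hξ j).1, inv_le_one_of_one_le₀ hR],
        (hξ j).2.le.trans (mul_rpow_neg_lt_one_of_mem_boxIndices hR0 hl j).le⟩
  calc ENNReal.ofReal (R⁻¹ ^ n) = volume {ξ : EuclideanSpace ℝ (Fin n) | ∀ j, ξ j ∈
        Set.Ioo (l j * R ^ (-σ) - R⁻¹) (l j * R ^ (-σ))} := by
        rw [volume_setOf_forall_coord_mem, ENNReal.ofReal_pow (by positivity)]
        simp only [Real.volume_Ioo, sub_sub_cancel, Finset.prod_const, Finset.card_univ,
          Fintype.card_fin]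
    _ ≤ volume (graphPt ⁻¹' freqBox σ R l ∩ paramCube n) := measure_mono hsub
    _ ≤ surfaceMeasure n (freqBox σ R l) := le_surfaceMeasure (measurableSet_freqBox σ R l)

open Classical in
/-- The number of frequency boxes that contain `ξ`, which is the value of `h` at `ξ`. -/
def boxCount (n : ℕ) (σ R : ℝ) (ξ : EuclideanSpace ℝ (Fin (n + 1))) : ℕ :=
  #{l ∈ boxIndices n σ R | ξ ∈ freqBox σ R l}

theorem h_eq_boxCount (n : ℕ) (σ R : ℝ) (ξ : EuclideanSpace ℝ (Fin (n + 1))) :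
    h n σ R ξ = boxCount n σ R ξ := by
  classical
  simp only [h, boxCount, boxIndices, Set.indicator_apply, Finset.sum_boole]

theorem enorm_h (n : ℕ) (σ R : ℝ) (ξ : EuclideanSpace ℝ (Fin (n + 1))) :
    ‖h n σ R ξ‖ₑ = boxCount n σ R ξ := by
  rw [h_eq_boxCount, ← ofReal_norm, Complex.norm_natCast, ENNReal.ofReal_natCast]

theorem lintegral_enorm_h (n : ℕ) (σ R : ℝ) :
    ∫⁻ ξ, ‖h n σ R ξ‖ₑ ∂(surfaceMeasure n) =
      ∑ l ∈ boxIndices n σ R, surfaceMeasure n (freqBox σ R l) := by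
  classical
  have hsum (ξ : EuclideanSpace ℝ (Fin (n + 1))) :
      ‖h n σ R ξ‖ₑ = ∑ l ∈ boxIndices n σ R, (freqBox σ R l).indicator 1 ξ := by
    simp only [enorm_h, boxCount, Set.indicator_apply, Pi.one_apply, Finset.sum_boole]
  simp_rw [hsum]
  rw [lintegral_finsetSum _ fun l _ => measurable_one.indicator (measurableSet_freqBox σ R l)]
  simp only [lintegral_indicator_one (measurableSet_freqBox σ R _)]

theorem comparable_lintegral_enorm_h (n : ℕ) (hσ : 0 < σ) (hR : 1 < R) :
    Comparable ((1 / 2) ^ n) ((1 + 4 * n) * 2 ^ n) (R ^ (n * (σ - 1)))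
      (∫⁻ ξ, ‖h n σ R ξ‖ₑ ∂(surfaceMeasure n)) := by
  have hR0 : 0 < R := by linarith
  have hbox (l) (hl : l ∈ boxIndices n σ R) :
      Comparable 1 ((1 + 4 * n) * 2 ^ n) (R⁻¹ ^ n) (surfaceMeasure n (freqBox σ R l)) :=
    ⟨by rw [one_mul]; exact le_surfaceMeasure_freqBox hR.le hl,
      surfaceMeasure_freqBox_le hR0.le σ l⟩
  have hsize : R ^ (n * (σ - 1)) = (R ^ σ) ^ n * R⁻¹ ^ n := by
    rw [mul_comm, Real.rpow_mul_natCast hR0.le, Real.rpow_sub_one hR0.ne', div_eq_mul_inv, mul_pow]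
  have hlower : (1 / 2) ^ n * R ^ (n * (σ - 1)) ≤ #(boxIndices n σ R) * R⁻¹ ^ n := by
    rw [hsize, ← mul_assoc, ← mul_pow, one_div_mul_eq_div]
    gcongr
    exact pow_half_le_card_boxIndices n hσ hR
  have hupper : #(boxIndices n σ R) * R⁻¹ ^ n ≤ 1 * R ^ (n * (σ - 1)) := by
    rw [hsize, one_mul]
    gcongr
    exact card_boxIndices_le n σ hR0.le
  rw [lintegral_enorm_h, ← one_mul ((1 / 2 : ℝ) ^ n), ← mul_one ((1 + 4 * n) * 2 ^ n : ℝ)]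
  exact (Comparable.sum hbox).trans zero_le_one (by positivity) hlower hupper

theorem boxCount_le (n : ℕ) (hσ : σ ≤ 1) (hR : 1 ≤ R) (ξ : EuclideanSpace ℝ (Fin (n + 1))) :
    boxCount n σ R ξ ≤ 3 ^ n := by
  classical
  have hR0 : 0 < R := by linarith
  have hs : 0 < R ^ (-σ) := by positivity
  have hsub : {l ∈ boxIndices n σ R | ξ ∈ freqBox σ R l} ⊆
      latticePointsNear (fun _ : Fin n => R ^ (-σ)) (fun j => ξ j.castSucc) fun _ => R⁻¹ := by
    intro l hl
    refine (mem_latticePointsNear fun _ => hs).2 fun j => ?_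
    have hξ := (Finset.mem_filter.1 hl).2 j
    exact abs_le.2 ⟨by linarith [hξ.2], by linarith [hξ.1]⟩
  have hgap : R⁻¹ ≤ R ^ (-σ) := by
    rw [← Real.rpow_neg_one]
    exact Real.rpow_le_rpow_of_exponent_le hR (by linarith)
  have hcard : (boxCount n σ R ξ : ℝ) ≤ 3 ^ n := by
    calc (boxCount n σ R ξ : ℝ) ≤ (2 * R⁻¹ / R ^ (-σ) + 1) ^ n := by
          refine (Nat.cast_le.2 (Finset.card_le_card hsub)).trans ?_
          simpa using card_latticePointsNear_le (ρ := fun _ : Fin n => R⁻¹) (fun _ => hs)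
            (fun _ => (inv_pos.2 hR0).le) fun j : Fin n => ξ j.castSucc
      _ ≤ (2 + 1) ^ n := by
          gcongr
          rw [div_le_iff₀ hs]
          gcongr
      _ = 3 ^ n := by norm_num
  exact_mod_cast hcard

/-- As `h` takes natural number values at most `3 ^ n`, its square is comparable to `h` itself. -/
theorem exists_comparable_eLpNorm_h (n : ℕ) : ∃ c > 0, ∃ C > 0, ∀ σ R : ℝ, 0 < σ → σ ≤ 1 → 1 < R →
    Comparable c C (R ^ (n * (σ - 1) / 2)) (eLpNorm (h n σ R) 2 (surfaceMeasure n)) := by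
  refine ⟨√((1 / 2) ^ n), by positivity, √(3 ^ n * ((1 + 4 * n) * 2 ^ n)), by positivity,
    fun σ R hσ hσ1 hR => ?_⟩
  have hR0 : 0 < R := by linarith
  have hh := comparable_lintegral_enorm_h n hσ hR
  have hsq : Comparable ((1 / 2) ^ n) (3 ^ n * ((1 + 4 * n) * 2 ^ n)) (R ^ (n * (σ - 1)))
      (∫⁻ ξ, ‖h n σ R ξ‖ₑ ^ 2 ∂(surfaceMeasure n)) := by
    have hlower (ξ) : ‖h n σ R ξ‖ₑ ≤ ‖h n σ R ξ‖ₑ ^ 2 := by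
      rw [enorm_h]
      exact_mod_cast Nat.le_self_pow two_ne_zero _
    have hupper (ξ) : ‖h n σ R ξ‖ₑ ^ 2 ≤ 3 ^ n * ‖h n σ R ξ‖ₑ := by
      rw [enorm_h, sq]
      exact_mod_cast Nat.mul_le_mul_right _ (boxCount_le n hσ1 hR.le ξ)
    refine ⟨hh.1.trans (lintegral_mono hlower), (lintegral_mono hupper).trans ?_⟩
    rw [lintegral_const_mul _ (measurable_h n σ R).enorm, mul_assoc (3 ^ n : ℝ),
      ENNReal.ofReal_mul (by positivity), ENNReal.ofReal_pow (by norm_num), ENNReal.ofReal_ofNat]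
    exact mul_le_mul_right hh.2 _
  have hroot : √(R ^ (n * (σ - 1))) = R ^ (n * (σ - 1) / 2) := by
    rw [Real.sqrt_eq_rpow, ← Real.rpow_mul hR0.le, mul_one_div]
  rw [eLpNorm_eq_lintegral_rpow_enorm_toReal two_ne_zero ENNReal.ofNat_ne_top, ← hroot]
  simpa only [ENNReal.toReal_ofNat, ENNReal.rpow_ofNat] using hsq.sqrt (by positivity)

end Density

section PeakCubes

variable {n : ℕ} {σ R : ℝ}

/-- The exponents `(σ, …, σ, 2σ)`: the peak lattice has spacing `R ^ spacingExp n σ i` in the `i`-th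
coordinate. -/
def spacingExp (n : ℕ) (σ : ℝ) : Fin (n + 1) → ℝ :=
  Fin.snoc (α := fun _ => ℝ) (fun _ => σ) (2 * σ)

@[simp]
theorem spacingExp_castSucc (n : ℕ) (σ : ℝ) (j : Fin n) : spacingExp n σ j.castSucc = σ := by
  simp [spacingExp]

@[simp]
theorem spacingExp_last (n : ℕ) (σ : ℝ) : spacingExp n σ (Fin.last n) = 2 * σ := by
  simp [spacingExp]

theorem spacingExp_nonneg (n : ℕ) (hσ : 0 ≤ σ) (i : Fin (n + 1)) : 0 ≤ spacingExp n σ i := by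
  induction i using Fin.lastCases with
  | last => simpa using hσ
  | cast j => simpa using hσ

theorem spacingExp_le_one (n : ℕ) (hσ : σ ≤ 1 / 2) (i : Fin (n + 1)) : spacingExp n σ i ≤ 1 := by
  induction i using Fin.lastCases with
  | last => rw [spacingExp_last]; linarith
  | cast j => rw [spacingExp_castSucc]; linarith

/-- The spacing of the peak lattice in each of the coordinate directions. -/
def spacing (n : ℕ) (σ R : ℝ) (i : Fin (n + 1)) : ℝ := R ^ spacingExp n σ i

theorem spacing_castSucc (n : ℕ) (σ R : ℝ) (j : Fin n) : spacing n σ R j.castSucc = R ^ σ := by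
  rw [spacing, spacingExp_castSucc]

theorem spacing_last (n : ℕ) (σ R : ℝ) : spacing n σ R (Fin.last n) = R ^ (2 * σ) := by
  rw [spacing, spacingExp_last]

theorem spacing_pos (n : ℕ) (σ : ℝ) (hR : 0 < R) (i : Fin (n + 1)) : 0 < spacing n σ R i :=
  Real.rpow_pos_of_pos hR _

theorem one_le_spacing (n : ℕ) (hσ : 0 ≤ σ) (hR : 1 ≤ R) (i : Fin (n + 1)) :
    1 ≤ spacing n σ R i :=
  Real.one_le_rpow hR (spacingExp_nonneg n hσ i)

theorem mem_peakLattice {x : EuclideanSpace ℝ (Fin (n + 1))} :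
    x ∈ peakLattice n σ R ↔ ∃ m : Fin (n + 1) → ℤ, ∀ i, x i = m i * spacing n σ R i := by
  simp only [peakLattice, Set.mem_ofPred_eq, Fin.forall_fin_succ', spacing_castSucc, spacing_last]

/-- The paper's exponent `α = d - (d + 1)σ`. -/
def fractalDim (n : ℕ) (σ : ℝ) : ℝ := n + 1 - (n + 2) * σ

theorem sum_one_sub_spacingExp (n : ℕ) (σ : ℝ) :
    ∑ i, (1 - spacingExp n σ i) = fractalDim n σ := by
  simp only [Fin.sum_univ_castSucc, spacingExp_castSucc, spacingExp_last, Finset.sum_const,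
    Finset.card_univ, Fintype.card_fin, nsmul_eq_mul, fractalDim]
  ring

theorem prod_rpow_one_sub_spacingExp (n : ℕ) (σ : ℝ) {r : ℝ} (hr : 0 < r) :
    ∏ i, r ^ (1 - spacingExp n σ i) = r ^ fractalDim n σ := by
  rw [← sum_one_sub_spacingExp, Real.rpow_sum_of_pos hr]

theorem mul_div_rpow_add_one_le {a r e : ℝ} (ha : 0 ≤ a) (hr : 1 ≤ r) (hrR : r ≤ R) (he : 0 ≤ e)
    (he1 : e ≤ 1) : a * r / R ^ e + 1 ≤ (a + 1) * r ^ (1 - e) := by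
  have hr0 : 0 < r := by linarith
  have hdiv : r / R ^ e ≤ r ^ (1 - e) := by
    rw [Real.rpow_sub hr0, Real.rpow_one]
    gcongr
  have hone : 1 ≤ r ^ (1 - e) := Real.one_le_rpow hr (by linarith)
  rw [mul_div_assoc, add_mul, one_mul]
  gcongr

theorem volume_unitCube {m : ℕ} (k : Fin m → ℤ) : volume (unitCube k) = 1 := by
  refine (volume_setOf_forall_coord_mem fun i => Set.Ico (k i : ℝ) (k i + 1)).trans ?_
  simp

theorem volume_cubeUnion_le {m : ℕ} {Q : Set (Fin m → ℤ)} (hQ : Q.Finite) :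
    volume (cubeUnion Q) ≤ Q.ncard := by
  lift Q to Finset (Fin m → ℤ) using hQ
  rw [Set.ncard_coe_finset]
  refine (measure_biUnion_finset_le Q unitCube).trans ?_
  simp [volume_unitCube]

theorem volume_inter_cubeUnion_le {m : ℕ} {Q : Set (Fin m → ℤ)} (hQ : Q.Finite)
    (s : Set (EuclideanSpace ℝ (Fin m))) :
    volume (s ∩ cubeUnion Q) ≤ {k ∈ Q | (unitCube k ∩ s).Nonempty}.ncard := by
  refine (measure_mono fun x hx => ?_).trans (volume_cubeUnion_le (hQ.subset (Set.sep_subset _ _)))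
  obtain ⟨k, hk, hxk⟩ := Set.mem_iUnion₂.1 hx.2
  exact Set.mem_iUnion₂.2 ⟨k, ⟨hk, x, hxk, hx.1⟩, hxk⟩

theorem abs_coord_sub_le_dist {ι : Type*} [Fintype ι] (x y : EuclideanSpace ℝ ι) (i : ι) :
    |x i - y i| ≤ dist x y :=
  PiLp.dist_apply_le x y i

theorem abs_coord_sub_le_one_of_mem_unitCube {m : ℕ} {k : Fin m → ℤ}
    {x : EuclideanSpace ℝ (Fin m)} (hx : x ∈ unitCube k) (i : Fin m) : |x i - k i| ≤ 1 :=
  abs_le.2 ⟨by linarith [(hx i).1], by linarith [(hx i).2]⟩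

theorem exists_peakLattice_near {k : Fin (n + 1) → ℤ} (hk : k ∈ peakCubes n σ R) :
    ∃ m : Fin (n + 1) → ℤ, (∀ i, |k i - m i * spacing n σ R i| ≤ 2) ∧
      ∀ i, |m i * spacing n σ R i| ≤ R := by
  obtain ⟨-, x, hxk, hx⟩ := hk
  obtain ⟨p, ⟨hp, hpR⟩, hxp⟩ := Metric.mem_thickening_iff.1 hx
  obtain ⟨m, hm⟩ := mem_peakLattice.1 hp
  refine ⟨m, fun i => ?_, fun i => ?_⟩ <;> rw [← hm i]
  · have hkx := abs_coord_sub_le_one_of_mem_unitCube hxk i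
    rw [abs_sub_comm] at hkx
    linarith [abs_sub_le (k i : ℝ) (x i) (p i), abs_coord_sub_le_dist x p i]
  · simpa using (abs_coord_sub_le_dist p 0 i).trans (Metric.mem_ball.1 hpR).le

theorem finite_peakCubes (n : ℕ) (σ R : ℝ) : (peakCubes n σ R).Finite := by
  refine (Finset.finite_toSet (latticePointsNear (fun _ => 1) 0 fun _ => R)).subset fun k hk => ?_
  refine Finset.mem_coe.2 ((mem_latticePointsNear fun _ => one_pos).2 fun i => ?_)
  have hcorner := hk.1 (show WithLp.toLp 2 (fun i => (k i : ℝ)) ∈ unitCube k from fun i => by simp)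
  simpa using (abs_coord_sub_le_dist _ 0 i).trans (Metric.mem_ball.1 hcorner).le

theorem cubeUnion_peakCubes_subset (n : ℕ) (σ R : ℝ) :
    cubeUnion (peakCubes n σ R) ⊆ Metric.ball 0 R :=
  Set.iUnion₂_subset fun _ hk => hk.1

theorem ncard_peakCubes_meeting_ball_le (hσ : 0 ≤ σ) (hσ2 : σ ≤ 1 / 2) {r : ℝ} (hr : 1 ≤ r)
    (hrR : r ≤ R) (x : EuclideanSpace ℝ (Fin (n + 1))) :
    ({k ∈ peakCubes n σ R | (unitCube k ∩ Metric.ball x r).Nonempty}.ncard : ℝ) ≤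
      45 ^ (n + 1) * r ^ fractalDim n σ := by
  have hr0 : 0 < r := by linarith
  have hs := spacing_pos n σ (hr0.trans_le hrR)
  set S := latticePointsNear (spacing n σ R) (x ·) fun _ => 4 * r
  have hS : ∀ k ∈ {k ∈ peakCubes n σ R | (unitCube k ∩ Metric.ball x r).Nonempty},
      ∃ m ∈ S, ∀ i, |k i - m i * spacing n σ R i| ≤ 2 := by
    rintro k ⟨hk, y, hyk, hy⟩
    obtain ⟨m, hm, -⟩ := exists_peakLattice_near hk
    refine ⟨m, (mem_latticePointsNear hs).2 fun i => ?_, hm⟩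
    have hmk := hm i
    have hky := abs_coord_sub_le_one_of_mem_unitCube hyk i
    have hyx := (abs_coord_sub_le_dist y x i).trans (Metric.mem_ball.1 hy).le
    rw [abs_le] at *
    constructor <;> linarith
  have hcard : (#S : ℝ) ≤ 9 ^ (n + 1) * r ^ fractalDim n σ := by
    calc (#S : ℝ) ≤ ∏ i, (2 * (4 * r) / spacing n σ R i + 1) :=
          card_latticePointsNear_le hs (fun _ => by positivity) _
      _ ≤ ∏ i, 9 * r ^ (1 - spacingExp n σ i) := by
          refine Finset.prod_le_prod (fun i _ => by have := hs i; positivity) fun i _ => ?_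
          rw [spacing, show 2 * (4 * r) = 8 * r by ring, show (9 : ℝ) = 8 + 1 by norm_num]
          exact mul_div_rpow_add_one_le (by norm_num) hr hrR (spacingExp_nonneg n hσ i)
            (spacingExp_le_one n hσ2 i)
      _ = 9 ^ (n + 1) * r ^ fractalDim n σ := by
          rw [Finset.prod_mul_distrib, prod_rpow_one_sub_spacingExp n σ hr0]; simp
  have hncard := ncard_le_of_forall_exists_near hS
  rw [Fintype.card_fin] at hncard
  calc _ ≤ (5 ^ (n + 1) * #S : ℝ) := by exact_mod_cast hncard
    _ ≤ 5 ^ (n + 1) * (9 ^ (n + 1) * r ^ fractalDim n σ) := by gcongr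
    _ = 45 ^ (n + 1) * r ^ fractalDim n σ := by rw [← mul_assoc, ← mul_pow]; norm_num

theorem hasFractalStructure_peakCubes (hσ : 0 ≤ σ) (hσ2 : σ ≤ 1 / 2) :
    HasFractalStructure (45 ^ (n + 1)) (fractalDim n σ) R (cubeUnion (peakCubes n σ R)) := by
  intro x r hr hrR _
  refine (volume_inter_cubeUnion_le (finite_peakCubes n σ R) _).trans ?_
  rw [← ENNReal.ofReal_natCast]
  exact ENNReal.ofReal_le_ofReal (ncard_peakCubes_meeting_ball_le hσ hσ2 hr hrR x)

theorem HasFractalStructure.mono {m : ℕ} {A A' α : ℝ} {Y : Set (EuclideanSpace ℝ (Fin m))}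
    (hY : HasFractalStructure A α R Y) (hA : A ≤ A') : HasFractalStructure A' α R Y :=
  fun x r hr hrR hB => (hY x r hr hrR hB).trans (ENNReal.ofReal_le_ofReal (by gcongr))

end PeakCubes

section Tubes

variable {n : ℕ} {σ R K : ℝ} {ξ : EuclideanSpace ℝ (Fin n)} {a : EuclideanSpace ℝ (Fin (n + 1))}

theorem abs_add_le_of_mem_tube {x : EuclideanSpace ℝ (Fin (n + 1))} (hx : x ∈ tube K R ξ a)
    (hξ : ξ ∈ paramCube n) (j : Fin n) :
    |x j.castSucc - a j.castSucc + 2 * ξ j * (x (Fin.last n) - a (Fin.last n))| ≤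
      3 * (K * R ^ (1 / 2 : ℝ)) := by
  obtain ⟨s, hs⟩ := Submodule.mem_span_singleton.1
    (Submodule.starProjection_apply_mem (Submodule.span ℝ {normalVec ξ}) (x - a))
  have hperp (i : Fin (n + 1)) : |x i - a i - s * normalVec ξ i| ≤ K * R ^ (1 / 2 : ℝ) := by
    refine le_trans ?_ hx.2
    rw [← hs]
    exact PiLp.norm_apply_le (x - a - s • normalVec ξ) i
  have hj := hperp j.castSucc
  have hlast := hperp (Fin.last n)
  simp only [normalVec, Fin.snoc_castSucc, Fin.snoc_last, mul_one] at hj hlast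
  calc _ = |(x j.castSucc - a j.castSucc - s * (-2 * ξ j)) +
          2 * ξ j * (x (Fin.last n) - a (Fin.last n) - s)| := by ring_nf
    _ ≤ |x j.castSucc - a j.castSucc - s * (-2 * ξ j)| +
          |2 * ξ j * (x (Fin.last n) - a (Fin.last n) - s)| := abs_add_le _ _
    _ ≤ K * R ^ (1 / 2 : ℝ) + 2 * 1 * (K * R ^ (1 / 2 : ℝ)) := by
        rw [abs_mul, abs_mul, abs_two]
        gcongr
        exact hξ j
    _ = 3 * (K * R ^ (1 / 2 : ℝ)) := by ring

theorem abs_peakLattice_sub_le_of_near_tube (hK : 1 ≤ K) (hR : 1 ≤ R) {k m : Fin (n + 1) → ℤ}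
    (hk : (unitCube k ∩ tube K R ξ a).Nonempty) (hξ : ξ ∈ paramCube n)
    (hm : ∀ i, |k i - m i * spacing n σ R i| ≤ 2) (j : Fin n) :
    |m j.castSucc * spacing n σ R j.castSucc - (a j.castSucc -
      2 * ξ j * (m (Fin.last n) * spacing n σ R (Fin.last n) - a (Fin.last n)))| ≤
      12 * (K * R ^ (1 / 2 : ℝ)) := by
  obtain ⟨x, hxk, hx⟩ := hk
  set p : Fin (n + 1) → ℝ := fun i => m i * spacing n σ R i
  have hpx (i : Fin (n + 1)) : |p i - x i| ≤ 3 := by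
    have hxk := abs_coord_sub_le_one_of_mem_unitCube hxk i
    rw [abs_sub_comm]
    linarith [abs_sub_le (x i) (k i : ℝ) (p i), hm i]
  have hw : 1 ≤ K * R ^ (1 / 2 : ℝ) :=
    one_le_mul_of_one_le_of_one_le hK (Real.one_le_rpow hR (by norm_num))
  calc _ = |(p j.castSucc - x j.castSucc) + 2 * ξ j * (p (Fin.last n) - x (Fin.last n)) +
          (x j.castSucc - a j.castSucc + 2 * ξ j * (x (Fin.last n) - a (Fin.last n)))| := by
        congr 1; ring
    _ ≤ |p j.castSucc - x j.castSucc| + |2 * ξ j * (p (Fin.last n) - x (Fin.last n))| +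
          |x j.castSucc - a j.castSucc + 2 * ξ j * (x (Fin.last n) - a (Fin.last n))| :=
        abs_add_three _ _ _
    _ ≤ 3 + 2 * 1 * 3 + 3 * (K * R ^ (1 / 2 : ℝ)) := by
        rw [abs_mul, abs_mul, abs_two]
        gcongr
        · exact hpx _
        · exact hξ j
        · exact hpx _
        · exact abs_add_le_of_mem_tube hx hξ j
    _ ≤ 12 * (K * R ^ (1 / 2 : ℝ)) := by linarith

theorem tube_count_bound_le (hσ : 0 ≤ σ) (hσ2 : σ ≤ 1 / 2) (hR : 1 ≤ R) (hK : 1 ≤ K) :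
    (2 * (12 * (K * R ^ (1 / 2 : ℝ))) / R ^ σ + 1) ^ n * (2 * R / R ^ (2 * σ) + 1) ≤
      25 ^ (n + 1) * K ^ n * R ^ (-(n : ℝ) / 2) * R ^ fractalDim n σ := by
  have hR0 : 0 < R := by linarith
  have hinit : 2 * (12 * (K * R ^ (1 / 2 : ℝ))) / R ^ σ + 1 ≤ 25 * K * R ^ (1 / 2 - σ) := by
    have hone : 1 ≤ K * R ^ (1 / 2 - σ) :=
      one_le_mul_of_one_le_of_one_le hK (Real.one_le_rpow hR (by linarith))
    calc _ = 24 * (K * R ^ (1 / 2 - σ)) + 1 := by rw [Real.rpow_sub hR0]; ring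
      _ ≤ 25 * K * R ^ (1 / 2 - σ) := by linarith
  have hlast : 2 * R / R ^ (2 * σ) + 1 ≤ 25 * R ^ (1 - 2 * σ) := by
    refine (mul_div_rpow_add_one_le zero_le_two hR le_rfl (by linarith) (by linarith)).trans ?_
    gcongr
    norm_num
  calc _ ≤ (25 * K * R ^ (1 / 2 - σ)) ^ n * (25 * R ^ (1 - 2 * σ)) := by gcongr
    _ = 25 ^ (n + 1) * K ^ n * ((R ^ (1 / 2 - σ)) ^ n * R ^ (1 - 2 * σ)) := by ring
    _ = 25 ^ (n + 1) * K ^ n * R ^ (-(n : ℝ) / 2) * R ^ fractalDim n σ := by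
        rw [mul_assoc _ (R ^ (-(n : ℝ) / 2)), ← Real.rpow_mul_natCast hR0.le,
          ← Real.rpow_add hR0, ← Real.rpow_add hR0, fractalDim]
        ring_nf

theorem ncard_peakCubes_meeting_tube_le (hσ : 0 ≤ σ) (hσ2 : σ ≤ 1 / 2) (hR : 1 ≤ R) (hK : 1 ≤ K)
    (hξ : ξ ∈ paramCube n) (a : EuclideanSpace ℝ (Fin (n + 1))) :
    ({k ∈ peakCubes n σ R | (unitCube k ∩ tube K R ξ a).Nonempty}.ncard : ℝ) ≤
      125 ^ (n + 1) * K ^ n * R ^ (-(n : ℝ) / 2) * R ^ fractalDim n σ := by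
  have hR0 : 0 < R := by linarith
  have hs := spacing_pos n σ hR0
  set t : ℤ → Fin n → ℝ := fun z j =>
    a j.castSucc - 2 * ξ j * (z * spacing n σ R (Fin.last n) - a (Fin.last n))
  set S := {m ∈ latticePointsNear (spacing n σ R) 0 fun _ => R | ∀ j : Fin n,
    |m j.castSucc * spacing n σ R j.castSucc - t (m (Fin.last n)) j| ≤
      12 * (K * R ^ (1 / 2 : ℝ))}
  have hS : ∀ k ∈ {k ∈ peakCubes n σ R | (unitCube k ∩ tube K R ξ a).Nonempty},
      ∃ m ∈ S, ∀ i, |k i - m i * spacing n σ R i| ≤ 2 := by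
    rintro k ⟨hk, hkT⟩
    obtain ⟨m, hm, hmR⟩ := exists_peakLattice_near hk
    refine ⟨m, Finset.mem_filter.2 ⟨(mem_latticePointsNear hs).2 fun i => ?_,
      abs_peakLattice_sub_le_of_near_tube hK hR hkT hξ hm⟩, hm⟩
    simpa using hmR i
  have hcard : (#S : ℝ) ≤ 25 ^ (n + 1) * K ^ n * R ^ (-(n : ℝ) / 2) * R ^ fractalDim n σ := by
    set ρ : Fin (n + 1) → ℝ := Fin.snoc (fun _ => 12 * (K * R ^ (1 / 2 : ℝ))) R
    have hρ (i : Fin (n + 1)) : 0 ≤ ρ i := by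
      induction i using Fin.lastCases with
      | last => simpa [ρ] using hR0.le
      | cast j => simp only [ρ, Fin.snoc_castSucc]; positivity
    calc (#S : ℝ) ≤ ∏ i, (2 * ρ i / spacing n σ R i + 1) := by
          refine card_le_prod_of_shear (t := t) (t' := 0) hs hρ (fun m hm => ?_) fun m hm j => ?_
          · simpa [ρ] using (mem_latticePointsNear hs).1 (Finset.mem_filter.1 hm).1 (Fin.last n)
          · simpa [ρ] using (Finset.mem_filter.1 hm).2 j
      _ = (2 * (12 * (K * R ^ (1 / 2 : ℝ))) / R ^ σ + 1) ^ n * (2 * R / R ^ (2 * σ) + 1) := by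
          simp [Fin.prod_univ_castSucc, ρ, spacing_castSucc, spacing_last]
      _ ≤ _ := tube_count_bound_le hσ hσ2 hR hK
  have hncard := ncard_le_of_forall_exists_near hS
  rw [Fintype.card_fin] at hncard
  calc _ ≤ (5 ^ (n + 1) * #S : ℝ) := by exact_mod_cast hncard
    _ ≤ 5 ^ (n + 1) * (25 ^ (n + 1) * K ^ n * R ^ (-(n : ℝ) / 2) * R ^ fractalDim n σ) := by gcongr
    _ = 125 ^ (n + 1) * K ^ n * R ^ (-(n : ℝ) / 2) * R ^ fractalDim n σ := by
        simp only [← mul_assoc, ← mul_pow]; norm_num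

theorem TubesHitSmallFraction.mono {A A' : ℝ} {Q : Set (Fin (n + 1) → ℤ)}
    (hQ : TubesHitSmallFraction A R Q) (hA : A ≤ A') (hR : 0 ≤ R) :
    TubesHitSmallFraction A' R Q := fun K hK ξ hξ a => by
  refine (hQ K hK ξ hξ a).trans ?_
  gcongr

end Tubes

section Oscillation

variable {n : ℕ} {σ R : ℝ}

/-- No cancellation: the real part of the integrand is at least `c * f`. -/
theorem le_enorm_integral_mul_exp_of_le_cos {α : Type*} [MeasurableSpace α] {μ : Measure α}
    {f θ : α → ℝ} {c : ℝ} (hf : Integrable f μ) (hf0 : ∀ a, 0 ≤ f a) (hθ : AEMeasurable θ μ)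
    (hcos : ∀ᵐ a ∂μ, f a ≠ 0 → c ≤ Real.cos (θ a)) :
    ENNReal.ofReal c * ∫⁻ a, ‖f a‖ₑ ∂μ ≤ ‖∫ a, f a * Complex.exp (θ a * Complex.I) ∂μ‖ₑ := by
  have hexp : AEStronglyMeasurable (fun a => Complex.exp (θ a * Complex.I)) μ := by
    fun_prop
  have hint : Integrable (fun a => f a * Complex.exp (θ a * Complex.I)) μ :=
    hf.ofReal.mul_bdd hexp (.of_forall fun a => (Complex.norm_exp_ofReal_mul_I (θ a)).le)
  have hre : c * ∫ a, f a ∂μ ≤ (∫ a, f a * Complex.exp (θ a * Complex.I) ∂μ).re := by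
    rw [← integral_const_mul, ← RCLike.re_eq_complex_re, ← integral_re hint]
    refine integral_mono_ae (hf.const_mul c) hint.re ?_
    filter_upwards [hcos] with a ha
    rw [RCLike.re_eq_complex_re, Complex.re_ofReal_mul, Complex.exp_ofReal_mul_I_re, mul_comm]
    rcases eq_or_ne (f a) 0 with h0 | h0
    · simp [h0]
    · exact mul_le_mul_of_nonneg_left (ha h0) (hf0 a)
  have hnorm : ∫⁻ a, ‖f a‖ₑ ∂μ = ENNReal.ofReal (∫ a, f a ∂μ) := by
    rw [← ofReal_integral_norm_eq_lintegral_enorm hf]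
    simp only [Real.norm_of_nonneg (hf0 _)]
  rw [hnorm, ← ENNReal.ofReal_mul' (integral_nonneg hf0), ← ofReal_norm]
  exact ENNReal.ofReal_le_ofReal (hre.trans (Complex.re_le_norm _))

theorem g_eq_integral_boxCount (n : ℕ) (σ R : ℝ) (x : EuclideanSpace ℝ (Fin (n + 1))) :
    g n σ R x = ∫ ξ, ((boxCount n σ R ξ : ℝ) : ℂ) *
      Complex.exp ((2 * Real.pi * inner ℝ x ξ : ℝ) * Complex.I) ∂(surfaceMeasure n) := by
  refine integral_congr_ae (.of_forall fun ξ => ?_)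
  simp only [h_eq_boxCount]
  push_cast
  ring_nf

theorem enorm_g_le (n : ℕ) (σ R : ℝ) (x : EuclideanSpace ℝ (Fin (n + 1))) :
    ‖g n σ R x‖ₑ ≤ ∫⁻ ξ, ‖h n σ R ξ‖ₑ ∂(surfaceMeasure n) := by
  rw [g_eq_integral_boxCount]
  refine (enorm_integral_le_lintegral_enorm _).trans_eq (lintegral_congr fun ξ => ?_)
  rw [h_eq_boxCount, Complex.ofReal_natCast, enorm_mul, ← ofReal_norm (Complex.exp _),
    Complex.norm_exp_ofReal_mul_I, ENNReal.ofReal_one, mul_one]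

theorem integrable_boxCount (n : ℕ) (hσ : 0 < σ) (hR : 1 < R) :
    Integrable (fun ξ => (boxCount n σ R ξ : ℝ)) (surfaceMeasure n) := by
  have hre : (fun ξ => (boxCount n σ R ξ : ℝ)) = fun ξ => (h n σ R ξ).re := by
    simp only [h_eq_boxCount, Complex.natCast_re]
  refine ⟨?_, ?_⟩
  · rw [hre]
    exact (Complex.measurable_re.comp (measurable_h n σ R)).aestronglyMeasurable
  · simp only [HasFiniteIntegral, Real.enorm_natCast, ← enorm_h]
    exact (comparable_lintegral_enorm_h n hσ hR).2.trans_lt ENNReal.ofReal_lt_top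

theorem ae_surfaceMeasure_of_forall_graphPt {p : EuclideanSpace ℝ (Fin (n + 1)) → Prop}
    (hp : MeasurableSet {ξ | p ξ}) (hgraph : ∀ ξ ∈ paramCube n, p (graphPt ξ)) :
    ∀ᵐ ξ ∂(surfaceMeasure n), p ξ := by
  rw [surfaceMeasure, ae_map_iff (measurable_graphPt n).aemeasurable hp]
  refine (withDensity_absolutelyContinuous _ _).ae_le ?_
  filter_upwards [ae_restrict_mem (measurableSet_paramCube n)] using hgraph

theorem le_enorm_g_of_half_le_cos (hσ : 0 < σ) (hR : 1 < R) {x : EuclideanSpace ℝ (Fin (n + 1))}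
    (hx : ∀ ξ ∈ paramCube n, ∀ l ∈ boxIndices n σ R, graphPt ξ ∈ freqBox σ R l →
      1 / 2 ≤ Real.cos (2 * Real.pi * inner ℝ x (graphPt ξ))) :
    ENNReal.ofReal (1 / 2) * ∫⁻ ξ, ‖h n σ R ξ‖ₑ ∂(surfaceMeasure n) ≤ ‖g n σ R x‖ₑ := by
  have hcos : ∀ᵐ ξ ∂(surfaceMeasure n), h n σ R ξ ≠ 0 →
      1 / 2 ≤ Real.cos (2 * Real.pi * inner ℝ x ξ) := by
    refine ae_surfaceMeasure_of_forall_graphPt ?_ fun ξ hξ hne => ?_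
    · exact (measurableSet_eq_fun (measurable_h n σ R) measurable_const).compl.imp
        (measurableSet_le measurable_const (by fun_prop))
    · rw [h] at hne
      obtain ⟨l, hl, hbox⟩ := Finset.exists_ne_zero_of_sum_ne_zero hne
      exact hx ξ hξ l hl (Set.mem_of_indicator_ne_zero hbox)
  have hmain := le_enorm_integral_mul_exp_of_le_cos (integrable_boxCount n hσ hR)
    (fun ξ => (boxCount n σ R ξ).cast_nonneg)
    (θ := fun ξ => 2 * Real.pi * inner ℝ x ξ) (c := 1 / 2) (by fun_prop) (by
      filter_upwards [hcos] with ξ hξ hne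
      exact hξ (by rw [h_eq_boxCount]; exact_mod_cast hne))
  rw [g_eq_integral_boxCount]
  simpa only [Real.enorm_natCast, enorm_h] using hmain

theorem half_le_cos_of_abs_sub_intCast_le {y : ℝ} {N : ℤ} (hy : |y - N| ≤ 1 / 6) :
    1 / 2 ≤ Real.cos (2 * Real.pi * y) := by
  have hperiod : Real.cos (2 * Real.pi * y) = Real.cos |2 * Real.pi * (y - N)| := by
    rw [Real.cos_abs, ← Real.cos_sub_int_mul_two_pi (2 * Real.pi * y) N]
    ring_nf
  rw [hperiod, ← Real.cos_pi_div_three]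
  refine Real.cos_le_cos_of_nonneg_of_le_pi (abs_nonneg _) (by linarith [Real.pi_pos]) ?_
  rw [abs_mul, abs_of_pos Real.two_pi_pos]
  nlinarith [Real.pi_pos]

theorem inner_graphPt (x : EuclideanSpace ℝ (Fin (n + 1))) (ξ : EuclideanSpace ℝ (Fin n)) :
    inner ℝ x (graphPt ξ) = ∑ j, (x j.castSucc * ξ j + x (Fin.last n) * ξ j ^ 2) := by
  rw [Finset.sum_add_distrib, ← Finset.mul_sum, PiLp.inner_apply, Fin.sum_univ_castSucc]
  simp [EuclideanSpace.norm_sq_eq, mul_comm]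

theorem abs_quadratic_phase_sub_le {p q x y ξ η δ : ℝ} (hR : 0 < R) (hx : |x - p| ≤ δ)
    (hy : |y - q| ≤ δ) (hp : |p| ≤ δ * R) (hq : |q| ≤ δ * R) (hξ : |ξ| ≤ 1) (hη : |η| ≤ 1)
    (hξη : |ξ - η| ≤ R⁻¹) :
    |x * ξ + y * ξ ^ 2 - (p * η + q * η ^ 2)| ≤ 5 * δ := by
  have hδ : 0 ≤ δ := (abs_nonneg _).trans hx
  have hsum : |ξ + η| ≤ 2 := (abs_add_le _ _).trans (by linarith)
  calc _ = |(x - p) * ξ + (y - q) * ξ ^ 2 + (p * (ξ - η) + q * ((ξ - η) * (ξ + η)))| := by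
        congr 1; ring
    _ ≤ |x - p| * |ξ| + |y - q| * |ξ| ^ 2 + (|p| * |ξ - η| + |q| * (|ξ - η| * |ξ + η|)) := by
        simp only [← abs_mul, ← abs_pow]
        exact (abs_add_le _ _).trans (add_le_add (abs_add_le _ _) (abs_add_le _ _))
    _ ≤ δ * 1 + δ * 1 ^ 2 + (δ * R * R⁻¹ + δ * R * (R⁻¹ * 2)) := by gcongr
    _ = 5 * δ := by field_simp; ring

/-- The scale at which the phases in the integral defining `g` stay coherent: near the peaks the
phase is within `5 * n * coherenceScale n ≤ 1 / 6` of an integer. -/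
def coherenceScale (n : ℕ) : ℝ := 1 / (30 * (n + 1))

theorem coherenceScale_pos (n : ℕ) : 0 < coherenceScale n := by
  rw [coherenceScale]; positivity

theorem mul_coherenceScale (n : ℕ) : (n + 1) * coherenceScale n = 1 / 30 := by
  rw [coherenceScale]; field_simp

theorem coherenceScale_le (n : ℕ) : coherenceScale n ≤ 1 / 30 := by
  rw [← mul_coherenceScale n]
  exact le_mul_of_one_le_left (coherenceScale_pos n).le (by simp)

theorem le_enorm_g_of_near_peakLattice (hσ : 0 < σ) (hR : 1 < R) {m : Fin (n + 1) → ℤ}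
    (hm : ∀ i, |m i * spacing n σ R i| ≤ coherenceScale n * R)
    {x : EuclideanSpace ℝ (Fin (n + 1))}
    (hx : ∀ i, |x i - m i * spacing n σ R i| ≤ coherenceScale n) :
    ENNReal.ofReal (1 / 2) * ∫⁻ ξ, ‖h n σ R ξ‖ₑ ∂(surfaceMeasure n) ≤ ‖g n σ R x‖ₑ := by
  have hR0 : 0 < R := by linarith
  refine le_enorm_g_of_half_le_cos hσ hR fun ξ hξ l hl hξl => ?_
  -- `p · (η, |η|²)` is an integer for `p` in the peak lattice and `η = R ^ (-σ) * l`.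
  refine half_le_cos_of_abs_sub_intCast_le
    (N := ∑ j : Fin n, (m j.castSucc * l j + m (Fin.last n) * l j ^ 2)) ?_
  have hinteger (j : Fin n) :
      ((m j.castSucc * l j + m (Fin.last n) * l j ^ 2 : ℤ) : ℝ) =
        m j.castSucc * spacing n σ R j.castSucc * (l j * R ^ (-σ)) +
          m (Fin.last n) * spacing n σ R (Fin.last n) * (l j * R ^ (-σ)) ^ 2 := by
    rw [spacing_castSucc, spacing_last, mul_comm 2 σ, Real.rpow_mul hR0.le, Real.rpow_neg hR0.le]
    push_cast
    norm_num
    field_simp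
  have hphase (j : Fin n) : |x j.castSucc * ξ j + x (Fin.last n) * ξ j ^ 2 -
      ((m j.castSucc * l j + m (Fin.last n) * l j ^ 2 : ℤ) : ℝ)| ≤ 5 * coherenceScale n := by
    have hbox := hξl j
    rw [graphPt_castSucc] at hbox
    have hl1 : (1 : ℝ) ≤ l j := by exact_mod_cast (mem_boxIndices.1 hl j).1
    rw [hinteger]
    refine abs_quadratic_phase_sub_le hR0 (hx _) (hx _) (hm _) (hm _) (hξ j) ?_
      (abs_le.2 ⟨by linarith [hbox.1], by linarith [hbox.2]⟩)
    rw [abs_of_nonneg (by positivity)]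
    exact (mul_rpow_neg_lt_one_of_mem_boxIndices hR0 hl j).le
  rw [inner_graphPt, Int.cast_sum, ← Finset.sum_sub_distrib]
  calc _ ≤ ∑ _j : Fin n, 5 * coherenceScale n :=
        (Finset.abs_sum_le_sum_abs _ _).trans (Finset.sum_le_sum fun j _ => hphase j)
    _ = n * (5 * coherenceScale n) := by simp
    _ ≤ 1 / 6 := by linarith [mul_coherenceScale n, coherenceScale_pos n]

end Oscillation

section Peaks

variable {n : ℕ} {σ R : ℝ}

/-- The points that have distance at most `δ` from `p` in each coordinate and lie in the same
lattice unit cube as `p`. -/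
def localBox {m : ℕ} (δ : ℝ) (p : Fin m → ℝ) : Set (EuclideanSpace ℝ (Fin m)) :=
  {x | ∀ i, x i ∈ Set.Icc (p i - δ) (p i + δ) ∩ Set.Ico (⌊p i⌋ : ℝ) (⌊p i⌋ + 1)}

theorem localBox_subset_unitCube {m : ℕ} (δ : ℝ) (p : Fin m → ℝ) :
    localBox δ p ⊆ unitCube fun i => ⌊p i⌋ := fun _ hx i => (hx i).2

theorem abs_sub_le_of_mem_localBox {m : ℕ} {δ : ℝ} {p : Fin m → ℝ}
    {x : EuclideanSpace ℝ (Fin m)} (hx : x ∈ localBox δ p) (i : Fin m) : |x i - p i| ≤ δ :=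
  abs_le.2 ⟨by linarith [(hx i).1.1], by linarith [(hx i).1.2]⟩

theorem measurableSet_localBox {m : ℕ} (δ : ℝ) (p : Fin m → ℝ) : MeasurableSet (localBox δ p) :=
  measurableSet_setOf_forall_mem (f := fun i (x : EuclideanSpace ℝ (Fin m)) => x i)
    (fun _ => by fun_prop) fun _ => measurableSet_Icc.inter measurableSet_Ico

theorem le_volume_Icc_inter_Ico_floor {δ : ℝ} (hδ : 0 ≤ δ) (hδ2 : δ ≤ 1 / 2) (p : ℝ) :
    ENNReal.ofReal δ ≤ volume (Set.Icc (p - δ) (p + δ) ∩ Set.Ico (⌊p⌋ : ℝ) (⌊p⌋ + 1)) := by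
  have hfloor := Int.floor_le p
  have hlt := Int.lt_floor_add_one p
  rcases le_or_gt (p + δ) (⌊p⌋ + 1) with hright | hleft
  · calc ENNReal.ofReal δ = volume (Set.Ico p (p + δ)) := by simp
      _ ≤ volume (Set.Icc (p - δ) (p + δ) ∩ Set.Ico (⌊p⌋ : ℝ) (⌊p⌋ + 1)) :=
        measure_mono fun y hy => ⟨⟨by linarith [hy.1], hy.2.le⟩,
          hfloor.trans hy.1, hy.2.trans_le hright⟩
  · calc ENNReal.ofReal δ = volume (Set.Ico (p - δ) p) := by simp
      _ ≤ volume (Set.Icc (p - δ) (p + δ) ∩ Set.Ico (⌊p⌋ : ℝ) (⌊p⌋ + 1)) :=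
        measure_mono fun y hy => ⟨⟨hy.1, by linarith [hy.2]⟩,
          by linarith [hy.1], hy.2.trans hlt⟩

theorem le_volume_localBox {m : ℕ} {δ : ℝ} (hδ : 0 ≤ δ) (hδ2 : δ ≤ 1 / 2) (p : Fin m → ℝ) :
    ENNReal.ofReal (δ ^ m) ≤ volume (localBox δ p) := by
  rw [localBox, volume_setOf_forall_coord_mem fun i =>
    Set.Icc (p i - δ) (p i + δ) ∩ Set.Ico (⌊p i⌋ : ℝ) (⌊p i⌋ + 1), ENNReal.ofReal_pow hδ]
  calc ENNReal.ofReal δ ^ m = ∏ _i : Fin m, ENNReal.ofReal δ := by simp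
    _ ≤ _ := Finset.prod_le_prod' fun i _ => le_volume_Icc_inter_Ico_floor hδ hδ2 (p i)

theorem disjoint_localBox {m : ℕ} {δ : ℝ} {p q : Fin m → ℝ} {i : Fin m}
    (hpq : 2 * δ < |p i - q i|) : Disjoint (localBox δ p) (localBox δ q) := by
  refine Set.disjoint_left.2 fun x hp hq => ?_
  have hxp := abs_sub_le_of_mem_localBox hp i
  rw [abs_sub_comm] at hxp
  linarith [abs_sub_le (p i) (x i) (q i), abs_sub_le_of_mem_localBox hq i]

/-- The indices of the peak lattice points near which `g` is shown to be large. -/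
def peakIndices (n : ℕ) (σ R : ℝ) : Finset (Fin (n + 1) → ℤ) :=
  latticePointsNear (spacing n σ R) 0 fun _ => coherenceScale n * R

theorem mem_peakIndices (hR : 0 < R) {m : Fin (n + 1) → ℤ} :
    m ∈ peakIndices n σ R ↔ ∀ i, |m i * spacing n σ R i| ≤ coherenceScale n * R := by
  rw [peakIndices, mem_latticePointsNear (spacing_pos n σ hR)]
  simp only [Pi.zero_apply, sub_zero]

theorem le_card_peakIndices (n : ℕ) (σ : ℝ) (hR : 0 < R) :
    coherenceScale n ^ (n + 1) * R ^ fractalDim n σ ≤ #(peakIndices n σ R) := by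
  have hδR : 0 ≤ coherenceScale n * R := mul_nonneg (coherenceScale_pos n).le hR.le
  calc coherenceScale n ^ (n + 1) * R ^ fractalDim n σ =
        ∏ i, coherenceScale n * R / spacing n σ R i := by
        simp only [spacing, mul_div_assoc, Finset.prod_mul_distrib,
          ← prod_rpow_one_sub_spacingExp n σ hR, Real.rpow_sub hR, Real.rpow_one,
          Finset.prod_const, Finset.card_univ, Fintype.card_fin]
    _ ≤ #(peakIndices n σ R) :=
        prod_div_le_card_latticePointsNear_zero (spacing_pos n σ hR) fun _ => hδR

/-- The part of `Y` on which `g` is shown to be large: the union of the local boxes around the peaks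
with index in `peakIndices`. -/
def peakSet (n : ℕ) (σ R : ℝ) : Set (EuclideanSpace ℝ (Fin (n + 1))) :=
  ⋃ m ∈ peakIndices n σ R, localBox (coherenceScale n) fun i => m i * spacing n σ R i

theorem measurableSet_peakSet (n : ℕ) (σ R : ℝ) : MeasurableSet (peakSet n σ R) :=
  Finset.measurableSet_biUnion _ fun _ _ => measurableSet_localBox _ _

theorem le_enorm_g_of_mem_peakSet (hσ : 0 < σ) (hR : 1 < R) {x : EuclideanSpace ℝ (Fin (n + 1))}
    (hx : x ∈ peakSet n σ R) :
    ENNReal.ofReal (1 / 2) * ∫⁻ ξ, ‖h n σ R ξ‖ₑ ∂(surfaceMeasure n) ≤ ‖g n σ R x‖ₑ := by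
  obtain ⟨m, hm, hxm⟩ := Set.mem_iUnion₂.1 hx
  exact le_enorm_g_of_near_peakLattice hσ hR ((mem_peakIndices (by linarith)).1 hm)
    (abs_sub_le_of_mem_localBox hxm)

theorem le_volume_peakSet (n : ℕ) (hσ : 0 ≤ σ) (hR : 1 ≤ R) :
    ENNReal.ofReal (coherenceScale n ^ (2 * (n + 1)) * R ^ fractalDim n σ) ≤
      volume (peakSet n σ R) := by
  have hδ := coherenceScale_pos n
  have hδ' := coherenceScale_le n
  have hdisj : (peakIndices n σ R : Set (Fin (n + 1) → ℤ)).PairwiseDisjoint fun m =>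
      localBox (coherenceScale n) fun i => m i * spacing n σ R i := by
    intro m _ m' _ hne
    obtain ⟨i, hi⟩ := Function.ne_iff.1 hne
    refine disjoint_localBox (i := i) ?_
    have hint : (1 : ℝ) ≤ |(m i : ℝ) - m' i| := by
      exact_mod_cast Int.one_le_abs (sub_ne_zero.2 hi)
    rw [← sub_mul, abs_mul, abs_of_pos (spacing_pos n σ (by linarith) i)]
    linarith [one_le_mul_of_one_le_of_one_le hint (one_le_spacing n hσ hR i)]
  rw [peakSet, measure_biUnion_finset hdisj fun _ _ => measurableSet_localBox _ _]
  calc _ ≤ ENNReal.ofReal (#(peakIndices n σ R) * coherenceScale n ^ (n + 1)) := by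
        refine ENNReal.ofReal_le_ofReal ?_
        rw [two_mul, pow_add, mul_right_comm]
        gcongr
        exact le_card_peakIndices n σ (by linarith)
    _ = #(peakIndices n σ R) • ENNReal.ofReal (coherenceScale n ^ (n + 1)) := by
        rw [ENNReal.ofReal_mul (Nat.cast_nonneg _), ENNReal.ofReal_natCast, nsmul_eq_mul]
    _ ≤ _ := Finset.card_nsmul_le_sum _ _ _ fun m _ =>
        le_volume_localBox hδ.le (by linarith) _

theorem abs_lt_max_of_mem_Ico_floor {s b x : ℝ} {m : ℤ} (hs : 1 ≤ s) (hb : |m * s| ≤ b)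
    (hx : x ∈ Set.Ico (⌊m * s⌋ : ℝ) (⌊m * s⌋ + 1)) : |x| < max 1 (2 * b) := by
  rcases eq_or_ne m 0 with rfl | hm
  · have : |x| < 1 := by
      simp only [Int.cast_zero, zero_mul, Int.floor_zero, zero_add, Set.mem_Ico] at hx
      exact (abs_of_nonneg hx.1).trans_lt hx.2
    exact lt_max_of_lt_left this
  · have hms : 1 ≤ |m * s| := by
      rw [abs_mul, abs_of_pos (by linarith : 0 < s)]
      exact one_le_mul_of_one_le_of_one_le (by exact_mod_cast Int.one_le_abs hm) hs
    have hxms : |x - m * s| < 1 := by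
      rw [abs_lt]
      constructor <;> linarith [hx.1, hx.2, Int.floor_le (m * s), Int.lt_floor_add_one (m * s)]
    refine lt_max_of_lt_right ?_
    linarith [abs_sub_abs_le_abs_sub x (m * s)]

theorem norm_lt_sqrt_card_mul {ι : Type*} [Fintype ι] [Nonempty ι] {x : EuclideanSpace ℝ ι}
    {b : ℝ} (hx : ∀ i, |x i| < b) : ‖x‖ < √(Fintype.card ι) * b := by
  have hb : 0 ≤ b := (abs_nonneg _).trans (hx (Classical.arbitrary ι)).le
  rw [EuclideanSpace.norm_eq, ← Real.sqrt_sq hb, ← Real.sqrt_mul (Nat.cast_nonneg _)]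
  refine Real.sqrt_lt_sqrt (by positivity) ?_
  calc ∑ i, ‖x i‖ ^ 2 < ∑ _i : ι, b ^ 2 :=
        Finset.sum_lt_sum_of_nonempty Finset.univ_nonempty fun i _ =>
          pow_lt_pow_left₀ (hx i) (abs_nonneg _) two_ne_zero
    _ = Fintype.card ι * b ^ 2 := by simp

theorem floor_mem_peakCubes (hσ : 0 ≤ σ) (hR : √(n + 1 : ℕ) ≤ R) {m : Fin (n + 1) → ℤ}
    (hm : m ∈ peakIndices n σ R) : (fun i => ⌊m i * spacing n σ R i⌋) ∈ peakCubes n σ R := by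
  have hsqrt : 1 ≤ √(n + 1 : ℕ) := Real.one_le_sqrt.2 (by simp)
  have hR1 : 1 ≤ R := hsqrt.trans hR
  have hcube : (unitCube fun i => ⌊m i * spacing n σ R i⌋) ⊆ Metric.ball 0 R := by
    intro x hx
    have hnorm := norm_lt_sqrt_card_mul fun i => abs_lt_max_of_mem_Ico_floor
      (one_le_spacing n hσ hR1 i) ((mem_peakIndices (by linarith)).1 hm i) (hx i)
    rw [Fintype.card_fin] at hnorm
    refine mem_ball_zero_iff.2 (hnorm.trans_le ?_)
    rw [mul_max_of_nonneg _ _ (Real.sqrt_nonneg _), mul_one]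
    refine max_le hR ?_
    calc √(n + 1 : ℕ) * (2 * (coherenceScale n * R))
        ≤ (n + 1 : ℕ) * (2 * (coherenceScale n * R)) := by
          have := coherenceScale_pos n
          gcongr
          exact Real.sqrt_le_self_iff.2 (by simp)
      _ = 2 * ((n + 1) * coherenceScale n) * R := by push_cast; ring
      _ ≤ R := by rw [mul_coherenceScale]; linarith
  set p : EuclideanSpace ℝ (Fin (n + 1)) := WithLp.toLp 2 fun i => m i * spacing n σ R i
  have hp : p ∈ unitCube fun i => ⌊m i * spacing n σ R i⌋ := fun i =>
    ⟨Int.floor_le _, Int.lt_floor_add_one _⟩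
  exact ⟨hcube, p, hp, Metric.self_subset_thickening one_pos _
    ⟨mem_peakLattice.2 ⟨m, fun _ => rfl⟩, hcube hp⟩⟩

theorem peakSet_subset_cubeUnion_peakCubes (hσ : 0 ≤ σ) (hR : √(n + 1 : ℕ) ≤ R) :
    peakSet n σ R ⊆ cubeUnion (peakCubes n σ R) :=
  Set.iUnion₂_subset fun _ hm => (localBox_subset_unitCube _ _).trans
    (Set.subset_biUnion_of_mem (u := unitCube) (floor_mem_peakCubes hσ hR hm))

theorem le_ncard_peakCubes (hσ : 0 ≤ σ) (hR : √(n + 1 : ℕ) ≤ R) :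
    coherenceScale n ^ (2 * (n + 1)) * R ^ fractalDim n σ ≤ (peakCubes n σ R).ncard := by
  have hR1 : 1 ≤ R := (Real.one_le_sqrt.2 (by simp)).trans hR
  have hvol := (le_volume_peakSet n hσ hR1).trans
    ((measure_mono (peakSet_subset_cubeUnion_peakCubes hσ hR)).trans
      (volume_cubeUnion_le (finite_peakCubes n σ R)))
  rw [← ENNReal.ofReal_natCast] at hvol
  exact (ENNReal.ofReal_le_ofReal_iff (Nat.cast_nonneg _)).1 hvol

theorem exists_tubesHitSmallFraction_peakCubes (n : ℕ) : ∃ A : ℝ, ∀ σ R : ℝ, 0 ≤ σ → σ ≤ 1 / 2 →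
    √(n + 1 : ℕ) ≤ R → TubesHitSmallFraction A R (peakCubes n σ R) := by
  refine ⟨125 ^ (n + 1) / coherenceScale n ^ (2 * (n + 1)), fun σ R hσ hσ2 hR K hK ξ hξ a => ?_⟩
  have hR1 : 1 ≤ R := (Real.one_le_sqrt.2 (by simp)).trans hR
  have hδ := coherenceScale_pos n
  have hncard : R ^ fractalDim n σ ≤
      (peakCubes n σ R).ncard / coherenceScale n ^ (2 * (n + 1)) := by
    rw [le_div_iff₀' (by positivity)]
    exact le_ncard_peakCubes hσ hR
  calc _ ≤ 125 ^ (n + 1) * K ^ n * R ^ (-(n : ℝ) / 2) * R ^ fractalDim n σ :=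
        ncard_peakCubes_meeting_tube_le hσ hσ2 hR1 hK hξ a
    _ ≤ 125 ^ (n + 1) * K ^ n * R ^ (-(n : ℝ) / 2) *
          ((peakCubes n σ R).ncard / coherenceScale n ^ (2 * (n + 1))) := by gcongr
    _ = _ := by ring

end Peaks

section Size

variable {n : ℕ} {σ R : ℝ}

theorem mul_measure_rpow_le_eLpNorm {α E : Type*} [MeasurableSpace α] {μ : Measure α}
    [TopologicalSpace E] [ContinuousENorm E] {p b : ℝ≥0∞} (hp : p ≠ 0) (hp' : p ≠ ∞) {f : α → E}
    {s t : Set α} (hs : MeasurableSet s) (hst : s ⊆ t) (hb : ∀ x ∈ s, b ≤ ‖f x‖ₑ) :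
    b * μ s ^ (1 / p.toReal) ≤ eLpNorm f p (μ.restrict t) := by
  calc b * μ s ^ (1 / p.toReal) = eLpNorm (fun _ => b) p (μ.restrict s) := by
        rw [eLpNorm_const' _ hp hp', Measure.restrict_apply_univ, enorm_eq_self]
    _ ≤ eLpNorm f p (μ.restrict s) := by
        refine eLpNorm_mono_enorm_ae ?_
        filter_upwards [ae_restrict_mem hs] using hb
    _ ≤ eLpNorm f p (μ.restrict t) := eLpNorm_mono_measure f (Measure.restrict_mono hst le_rfl)

theorem eLpNorm_restrict_le_mul_measure_rpow {α E : Type*} [MeasurableSpace α] {μ : Measure α}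
    [TopologicalSpace E] [ContinuousENorm E] {p b : ℝ≥0∞} (hp : p ≠ 0) (hp' : p ≠ ∞) {f : α → E}
    (t : Set α) (hb : ∀ x, ‖f x‖ₑ ≤ b) :
    eLpNorm f p (μ.restrict t) ≤ b * μ t ^ (1 / p.toReal) := by
  calc eLpNorm f p (μ.restrict t) ≤ eLpNorm (fun _ => b) p (μ.restrict t) :=
        eLpNorm_mono_enorm fun x => by simpa using hb x
    _ = b * μ t ^ (1 / p.toReal) := by
        rw [eLpNorm_const' _ hp hp', Measure.restrict_apply_univ, enorm_eq_self]

theorem volume_cubeUnion_peakCubes_le (hσ : 0 ≤ σ) (hσ2 : σ ≤ 1 / 2) (hR : 1 ≤ R) :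
    volume (cubeUnion (peakCubes n σ R)) ≤ ENNReal.ofReal (45 ^ (n + 1) * R ^ fractalDim n σ) := by
  have hball := hasFractalStructure_peakCubes (n := n) hσ hσ2 0 R hR le_rfl subset_rfl
  rwa [Set.inter_eq_right.2 (cubeUnion_peakCubes_subset n σ R)] at hball

theorem ofReal_mul_rpow_rpow_one_half {b s : ℝ} (hb : 0 ≤ b) (hR : 0 ≤ R) :
    ENNReal.ofReal (b * R ^ s) ^ (1 / 2 : ℝ) = ENNReal.ofReal (√b * R ^ (s / 2)) := by
  rw [← ofReal_sqrt, Real.sqrt_mul hb, Real.sqrt_eq_rpow (R ^ _), ← Real.rpow_mul hR, mul_one_div]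

theorem le_eLpNorm_g (hσ : 0 < σ) (hR : 1 < R) (hsqrt : √(n + 1 : ℕ) ≤ R) :
    ENNReal.ofReal ((1 / 2) ^ (n + 1) * coherenceScale n ^ (n + 1) *
      R ^ (n * (σ - 1) + fractalDim n σ / 2)) ≤
        eLpNorm (g n σ R) 2 (volume.restrict (cubeUnion (peakCubes n σ R))) := by
  have hδ := coherenceScale_pos n
  have hR0 : 0 < R := by linarith
  have hvol := ENNReal.rpow_le_rpow (le_volume_peakSet n hσ.le hR.le) one_half_pos.le
  rw [ofReal_mul_rpow_rpow_one_half (by positivity) hR0.le, mul_comm 2, pow_mul,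
    Real.sqrt_sq (by positivity)] at hvol
  calc _ = ENNReal.ofReal (1 / 2) * ENNReal.ofReal ((1 / 2) ^ n * R ^ (n * (σ - 1))) *
        ENNReal.ofReal (coherenceScale n ^ (n + 1) * R ^ (fractalDim n σ / 2)) := by
        rw [← ENNReal.ofReal_mul (by positivity), ← ENNReal.ofReal_mul (by positivity),
          Real.rpow_add hR0]
        ring_nf
    _ ≤ ENNReal.ofReal (1 / 2) * (∫⁻ ξ, ‖h n σ R ξ‖ₑ ∂(surfaceMeasure n)) *
        volume (peakSet n σ R) ^ (1 / 2 : ℝ) := by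
        gcongr
        exact (comparable_lintegral_enorm_h n hσ hR).1
    _ ≤ _ := mul_measure_rpow_le_eLpNorm two_ne_zero ENNReal.ofNat_ne_top
        (measurableSet_peakSet n σ R) (peakSet_subset_cubeUnion_peakCubes hσ.le hsqrt)
        fun x hx => le_enorm_g_of_mem_peakSet hσ hR hx

theorem eLpNorm_g_le (hσ : 0 < σ) (hσ2 : σ ≤ 1 / 2) (hR : 1 < R) :
    eLpNorm (g n σ R) 2 (volume.restrict (cubeUnion (peakCubes n σ R))) ≤
      ENNReal.ofReal ((1 + 4 * n) * 2 ^ n * √(45 ^ (n + 1)) *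
        R ^ (n * (σ - 1) + fractalDim n σ / 2)) := by
  have hR0 : 0 < R := by linarith
  have hvol := ENNReal.rpow_le_rpow
    (volume_cubeUnion_peakCubes_le (n := n) hσ.le hσ2 hR.le) one_half_pos.le
  rw [ofReal_mul_rpow_rpow_one_half (by positivity) hR0.le] at hvol
  calc _ ≤ (∫⁻ ξ, ‖h n σ R ξ‖ₑ ∂(surfaceMeasure n)) *
        volume (cubeUnion (peakCubes n σ R)) ^ (1 / 2 : ℝ) :=
        eLpNorm_restrict_le_mul_measure_rpow two_ne_zero ENNReal.ofNat_ne_top _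
          (enorm_g_le n σ R)
    _ ≤ ENNReal.ofReal ((1 + 4 * n) * 2 ^ n * R ^ (n * (σ - 1))) *
        ENNReal.ofReal (√(45 ^ (n + 1)) * R ^ (fractalDim n σ / 2)) := by
        gcongr
        exact (comparable_lintegral_enorm_h n hσ hR).2
    _ = _ := by
        rw [← ENNReal.ofReal_mul (by positivity), Real.rpow_add hR0]
        ring_nf

theorem exists_comparable_eLpNorm_g (n : ℕ) : ∃ c > 0, ∃ C > 0, ∀ σ R : ℝ, 0 < σ → σ ≤ 1 / 2 →
    1 < R → √(n + 1 : ℕ) ≤ R → Comparable c C (R ^ (n * (σ - 1) + fractalDim n σ / 2))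
      (eLpNorm (g n σ R) 2 (volume.restrict (cubeUnion (peakCubes n σ R)))) := by
  have hδ := coherenceScale_pos n
  exact ⟨(1 / 2) ^ (n + 1) * coherenceScale n ^ (n + 1), by positivity,
    (1 + 4 * n) * 2 ^ n * √(45 ^ (n + 1)), by positivity, fun σ R hσ hσ2 hR hsqrt =>
      ⟨le_eLpNorm_g hσ hR hsqrt, eLpNorm_g_le hσ hσ2 hR⟩⟩

end Size

section Sharpness

variable {n : ℕ} {σ R : ℝ}

theorem one_lt_of_sqrt_succ_le (hn : 1 ≤ n) (hR : √(n + 1 : ℕ) ≤ R) : 1 < R := by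
  refine lt_of_lt_of_le ?_ hR
  rw [Real.lt_sqrt zero_le_one, one_pow]
  exact_mod_cast Nat.lt_succ_of_le hn

theorem fractalDim_pos (n : ℕ) (hσ : σ < 1 / 2) : 0 < fractalDim n σ := by
  rw [fractalDim]
  nlinarith [(n.cast_nonneg : (0 : ℝ) ≤ n)]

theorem gain_exponent_eq (n : ℕ) (σ : ℝ) :
    1 / ((n + 1 : ℕ) + 1 : ℝ) * (fractalDim n σ - ((n + 1 : ℕ) - 1) / 2) = 1 / 2 - σ := by
  rw [fractalDim]
  push_cast
  field_simp
  ring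

theorem size_exponent_eq (n : ℕ) (σ : ℝ) :
    ((n + 1 : ℕ) - 3 : ℝ) / 2 * σ - ((n + 1 : ℕ) - 2) / 2 =
      n * (σ - 1) + fractalDim n σ / 2 := by
  rw [fractalDim]
  push_cast
  ring

theorem gain_exponent_add_eq (n : ℕ) (σ : ℝ) :
    1 / 2 - σ + n * (σ - 1) / 2 = n * (σ - 1) + fractalDim n σ / 2 := by
  rw [fractalDim]
  ring

theorem rpow_gain_mul_rpow (n : ℕ) (σ ε : ℝ) (hR : 0 < R) :
    R ^ (1 / 2 - σ + ε) * R ^ (n * (σ - 1) / 2) =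
      R ^ (n * (σ - 1) + fractalDim n σ / 2 + ε) := by
  rw [← Real.rpow_add hR, add_right_comm, gain_exponent_add_eq]

end Sharpness

end BBCRV

end

theorem mainTheorem2 (n d : ℕ) (hd : 2 ≤ d) (hdn : d = n + 1) :
    ∃ c C : ℝ, 0 < c ∧ 0 < C ∧
      ∀ σ α : ℝ, 0 < σ → σ < 1 / 2 → α = d - (d + 1) * σ →
        0 < α ∧
        -- `Y` and `g` satisfy the hypotheses of the estimate, and both sides have the stated size
        (∀ R : ℝ, Real.sqrt d ≤ R →
          (BBCRV.peakCubes n σ R).Finite ∧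
          BBCRV.cubeUnion (BBCRV.peakCubes n σ R) ⊆ Metric.ball 0 R ∧
          BBCRV.HasFractalStructure C α R (BBCRV.cubeUnion (BBCRV.peakCubes n σ R)) ∧
          BBCRV.TubesHitSmallFraction C R (BBCRV.peakCubes n σ R) ∧
          ENNReal.ofReal (c * R ^ (((d : ℝ) - 3) / 2 * σ - ((d : ℝ) - 2) / 2)) ≤
            MeasureTheory.eLpNorm (BBCRV.g n σ R) 2
              (MeasureTheory.volume.restrict (BBCRV.cubeUnion (BBCRV.peakCubes n σ R))) ∧
          MeasureTheory.eLpNorm (BBCRV.g n σ R) 2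
              (MeasureTheory.volume.restrict (BBCRV.cubeUnion (BBCRV.peakCubes n σ R))) ≤
            ENNReal.ofReal (C * R ^ (((d : ℝ) - 3) / 2 * σ - ((d : ℝ) - 2) / 2)) ∧
          ∀ ε : ℝ, 0 ≤ ε →
            ENNReal.ofReal (c * R ^ (((d : ℝ) - 3) / 2 * σ - ((d : ℝ) - 2) / 2 + ε)) ≤
              ENNReal.ofReal (R ^ (1 / ((d : ℝ) + 1) * (α - ((d : ℝ) - 1) / 2) + ε)) *
                MeasureTheory.eLpNorm (BBCRV.h n σ R) 2 (BBCRV.surfaceMeasure n) ∧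
            ENNReal.ofReal (R ^ (1 / ((d : ℝ) + 1) * (α - ((d : ℝ) - 1) / 2) + ε)) *
                MeasureTheory.eLpNorm (BBCRV.h n σ R) 2 (BBCRV.surfaceMeasure n) ≤
              ENNReal.ofReal (C * R ^ (((d : ℝ) - 3) / 2 * σ - ((d : ℝ) - 2) / 2 + ε))) ∧
        -- almost sharpness: the estimate fails with any smaller power of `R`
        (∀ β : ℝ, β < 1 / ((d : ℝ) + 1) * (α - ((d : ℝ) - 1) / 2) → ∀ A : ℝ,
          ∀ᶠ R : ℝ in Filter.atTop,
            ENNReal.ofReal (A * R ^ β) *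
                MeasureTheory.eLpNorm (BBCRV.h n σ R) 2 (BBCRV.surfaceMeasure n) <
              MeasureTheory.eLpNorm (BBCRV.g n σ R) 2
                (MeasureTheory.volume.restrict
                  (BBCRV.cubeUnion (BBCRV.peakCubes n σ R)))) := by
  subst hdn
  obtain ⟨cg, hcg, Cg, hCg, hg⟩ := BBCRV.exists_comparable_eLpNorm_g n
  obtain ⟨ch, hch, Ch, hCh, hh⟩ := BBCRV.exists_comparable_eLpNorm_h n
  obtain ⟨Ct, htubes⟩ := BBCRV.exists_tubesHitSmallFraction_peakCubes n
  obtain ⟨C, hCgC, hChC, hCfC, hCtC⟩ : ∃ C, Cg ≤ C ∧ Ch ≤ C ∧ 45 ^ (n + 1) ≤ C ∧ Ct ≤ C :=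
    ⟨max (max Cg Ch) (max (45 ^ (n + 1)) Ct), by simp⟩
  refine ⟨min cg ch, C, lt_min hcg hch, hCg.trans_le hCgC, fun σ α hσ hσ2 hα => ?_⟩
  obtain rfl : α = BBCRV.fractalDim n σ := by rw [hα, BBCRV.fractalDim]; push_cast; ring
  have hone {R : ℝ} := BBCRV.one_lt_of_sqrt_succ_le (R := R) (Nat.le_of_succ_le_succ hd)
  have hg' (R : ℝ) (hR : √(n + 1 : ℕ) ≤ R) := hg σ R hσ hσ2.le (hone hR) hR
  have hh' (R : ℝ) (hR : √(n + 1 : ℕ) ≤ R) := hh σ R hσ (by linarith) (hone hR)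
  rw [BBCRV.gain_exponent_eq, BBCRV.size_exponent_eq]
  refine ⟨BBCRV.fractalDim_pos n hσ2, fun R hR => ?_, fun β hβ A => ?_⟩
  · have hR0 : 0 < R := zero_lt_one.trans (hone hR)
    have hg_size := (hg' R hR).mono (min_le_left cg ch) hCgC (by positivity)
    have hh_size := (hh' R hR).mono (min_le_right cg ch) hChC (by positivity)
    refine ⟨BBCRV.finite_peakCubes n σ R, BBCRV.cubeUnion_peakCubes_subset n σ R,
      (BBCRV.hasFractalStructure_peakCubes hσ.le hσ2.le).mono hCfC,
      (htubes σ R hσ.le hσ2.le hR).mono hCtC hR0.le, hg_size.1, hg_size.2, fun ε _ => ?_⟩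
    rw [← BBCRV.rpow_gain_mul_rpow n σ ε hR0]
    exact hh_size.ofReal_mul (by positivity)
  · have hlarge := Filter.eventually_ge_atTop √(n + 1 : ℕ)
    exact BBCRV.eventually_ofReal_mul_rpow_mul_lt hcg hCh.le (hlarge.mono fun R hR => (hg' R hR).1)
      (hlarge.mono fun R hR => (hh' R hR).2) (by linarith [BBCRV.gain_exponent_add_eq n σ]) A
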